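/- **Setting.** Let $e_1,\dots,e_4$ be the standard basis of Euclidean $\mathbb{R}^4$ and let $\alpha_i=e_i-e_{i+1}$ ($i=1,2,3$) be the simple roots of $\mathfrak{sl}_4(\mathbb{C})$, with positive roots $\Phi^+=\{\alpha_1,\alpha_2,\alpha_3,\alpha_1+\alpha_2,\alpha_2+\alpha_3,\alpha_1+\alpha_2+\alpha_3\}$, fundamental weights $\varpi_1=\frac14(3\alpha_1+2\alpha_2+\alpha_3)$, $\varpi_2=\frac12(\alpha_1+2\alpha_2+\alpha_3)$, $\varpi_3=\frac14(\alpha_1+2\alpha_2+3\alpha_3)$, and $\rho=\frac12\sum_{\alpha\in\Phi^+}\alpha$. Let $s_i$ be the orthogonal reflection in the hyperplane $\alpha_i^\perp$ and let $W$ be the Weyl group generated by $s_1,s_2,s_3$. Let $\wp(\xi)$ be the number of ways of writing $\xi$ as a sum of positive roots with nonnegative integral multiplicities (Kostant's partition function). The Weyl alternation set of weights $\lambda,\mu$ is $$\mathcal{A}(\lambda,\mu)=\{\sigma\in W:\wp(\sigma(\lambda+\rho)-(\mu+\rho))>0\}.$$ **Notation.** For $c_1,c_2,c_3\in\mathbb{N}=\{0,1,2,\dots\}$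 and $x,y,z\in\mathbb{Z}$ put - $L_1=x$, $L_2=-c_1-c_2-c_3-z-3$, $L_3=-c_1-c_2-y+z-2$, $L_4=-c_1-x+y-1$, - $L_5=y$, $L_6=-c_1-2c_2-c_3-y-4$, $L_7=-c_1-c_2-c_3-x+y-z-3$, $L_8=-c_1-c_2-x+z-2$, $L_9=-c_2-c_3+x-z-2$, $L_{10}=-c_2+x-y+z-1$, - $L_{11}=z$, $L_{12}=-c_1-c_2-c_3-x-3$, $L_{13}=-c_2-c_3+x-y-2$, $L_{14}=-c_3+y-z-1$, and let $K_i$ be the condition $L_i\ge 0$. **Theorem.** $W$ has exactly 24 elements, represented without repetition by the words in the list in part 1. Fix $\mu=c_1\varpi_1+c_2\varpi_2+c_3\varpi_3$ with $c_1,c_2,c_3\in\mathbb{N}$, and for $x,y,z\in\mathbb{Z}$ let $\lambda=(2x-y+c_1)\varpi_1+(2y-x-z+c_2)\varpi_2+(2z-y+c_3)\varpi_3$. Then: 1. For all $x,y,z\in\mathbb{Z}$ and $\sigma\in W$, $\sigma(\lambda+\rho)-\rho-\mu=L_i\alpha_1+L_j\alpha_2+L_k\alpha_3$, and $\sigma\in\mathcal{A}(\lambda,\mu)$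 if and only if $K_i$, $K_j$ and $K_k$ hold, where $(L_i,L_j,L_k)$ is given by the following list. - $1$: $(L_{1}, L_{5}, L_{11})$ - $s_1$: $(L_{4}, L_{5}, L_{11})$ - $s_2$: $(L_{1}, L_{10}, L_{11})$ - $s_3$: $(L_{1}, L_{5}, L_{14})$ - $s_1s_2$: $(L_{3}, L_{10}, L_{11})$ - $s_2s_1$: $(L_{4}, L_{8}, L_{11})$ - $s_2s_3$: $(L_{1}, L_{9}, L_{14})$ - $s_3s_1$: $(L_{4}, L_{5}, L_{14})$ - $s_3s_2$: $(L_{1}, L_{10}, L_{13})$ - $s_1s_2s_1$: $(L_{3}, L_{8}, L_{11})$ - $s_1s_2s_3$: $(L_{2}, L_{9}, L_{14})$ - $s_2s_3s_1$: $(L_{4}, L_{7}, L_{14})$ - $s_2s_3s_2$: $(L_{1}, L_{9}, L_{13})$ - $s_3s_1s_2$: $(L_{3}, L_{10}, L_{13})$ - $s_3s_2s_1$: $(L_{4}, L_{8}, L_{12})$ - $s_1s_2s_3s_1$: $(L_{2}, L_{7}, L_{14})$ - $s_1s_2s_3s_2$: $(L_{2}, L_{9}, L_{13})$ - $s_2s_3s_1s_2$: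 $(L_{3}, L_{6}, L_{13})$ - $s_2s_3s_2s_1$: $(L_{4}, L_{7}, L_{12})$ - $s_3s_1s_2s_1$: $(L_{3}, L_{8}, L_{12})$ - $s_1s_2s_3s_1s_2$: $(L_{2}, L_{6}, L_{13})$ - $s_1s_2s_3s_2s_1$: $(L_{2}, L_{7}, L_{12})$ - $s_2s_3s_1s_2s_1$: $(L_{3}, L_{6}, L_{12})$ - $s_1s_2s_3s_1s_2s_1$: $(L_{2}, L_{6}, L_{12})$ 2. As $x,y,z$ range over $\mathbb{Z}$, exactly 195 distinct sets $\mathcal{A}(\lambda,\mu)$ occur: the empty set and the 194 nonempty sets listed in part 4. In particular the collection of sets that occur does not depend on $\mu$. 3. The maximum cardinality of $\mathcal{A}(\lambda,\mu)$, as $x,y,z$ range over $\mathbb{Z}$, is $6$. 4. For each row of the following list and all $x,y,z\in\mathbb{Z}$, $\mathcal{A}(\lambda,\mu)$ is the set of that row if and only if the conditions of that row hold; and $\mathcal{A}(\lambda,\mu)=\varnothing$ if and only if the conditions of no row hold. In the list, $e$ denotes the identity and a string of digits such as $123$ denotes $s_1s_2s_3$. A row $A : i_1,\dots,i_p\ ;\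 J_1,\dots,J_q$ stands for the set $A$ and the conditions: $K_{i_1},\dots,K_{i_p}$ all hold, and for each $t$ at least one of the $K_j$ with $j\in J_t$ fails (a one-element set $J_t=\{j\}$ is written $j$). 1. $\{e\}$ : $11,1,5\ ;\ 10, 4, 14, \{2,7,12\}, \{2,6,12\}, \{3,6,12\}, \{3,8\}, \{9,13\}, \{2,6,13\}, \{3,6,13\}$ 2. $\{1\}$ : $11,5,4\ ;\ 1, 14, 8, \{2,6,12\}, \{3,6,12\}, \{3,10\}, \{12,7\}, \{2,6,13\}, \{3,6,13\}, \{2,9,13\}$ 3. $\{2\}$ : $11,10,1\ ;\ 5, 13, 3, \{2,7,12\}, \{2,6,12\}, \{2,7,14\}, \{9,14\}, \{12,7,4\}, \{7,14,4\}, \{8,4\}$ 4. $\{3\}$ : $1,14,5\ ;\ 11, 9, 4, \{2,6,12\}, \{2,7\}, \{10,13\}, \{3,6,12\}, \{3,8,12\}, \{2,6,13\}, \{3,6,13\}$ 5. $\{12\}$ : $3,10,11\ ;\ 1, 8, 13, \{2,7,12\}, \{2,7,14\}, \{5,4\}, \{6,12\}, \{2,9,14\}, \{12,7,4\}, \{7,14,4\}$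 6. $\{21\}$ : $11,8,4\ ;\ 5, 3, 12, \{10,1\}, \{1,9,14\}, \{2,9,14\}, \{1,9,13\}, \{2,6,13\}, \{7,14\}, \{2,9,13\}$ 7. $\{23\}$ : $1,9,14\ ;\ 5, 2, 13, \{11,10\}, \{3,6,12\}, \{3,11,8\}, \{8,12,4\}, \{3,8,12\}, \{7,4\}, \{11,8,4\}$ 8. $\{31\}$ : $14,5,4\ ;\ 11, 1, 7, \{2,6,12\}, \{3,6,12\}, \{8,12\}, \{2,9\}, \{2,6,13\}, \{3,10,13\}, \{3,6,13\}$ 9. $\{32\}$ : $10,1,13\ ;\ 11, 9, 3, \{2,7,12\}, \{2,7,14\}, \{8,12,4\}, \{14,5\}, \{12,7,4\}, \{2,6\}, \{7,14,4\}$ 10. $\{121\}$ : $3,11,8\ ;\ 10, 12, 4, \{1,5\}, \{2,7,14\}, \{1,9,14\}, \{2,9,14\}, \{1,9,13\}, \{6,13\}, \{2,9,13\}$ 11. $\{123\}$ : $2,9,14\ ;\ 7, 1, 13, \{6,12\}, \{3,11,8\}, \{8,12,4\}, \{3,10,11\}, \{3,8,12\}, \{5,4\}, \{11,8,4\}$ 12.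 $\{231\}$ : $7,14,4\ ;\ 2, 12, 5, \{11,10,1\}, \{10,1,13\}, \{1,9\}, \{3,10,11\}, \{3,10,13\}, \{3,6,13\}, \{11,8\}$ 13. $\{232\}$ : $1,9,13\ ;\ 10, 14, 2, \{11,5\}, \{3,11,8\}, \{8,12,4\}, \{12,7,4\}, \{3,8,12\}, \{3,6\}, \{11,8,4\}$ 14. $\{312\}$ : $3,10,13\ ;\ 1, 11, 6, \{2,7,12\}, \{2,7,14\}, \{12,7,4\}, \{8,12\}, \{14,5,4\}, \{7,14,4\}, \{2,9\}$ 15. $\{321\}$ : $8,4,12\ ;\ 7, 3, 11, \{2,6\}, \{10,1,13\}, \{1,9,14\}, \{2,9,14\}, \{1,9,13\}, \{14,5\}, \{2,9,13\}$ 16. $\{1231\}$ : $2,7,14\ ;\ 12, 9, 4, \{11,10,1\}, \{10,1,13\}, \{3,11,8\}, \{1,5\}, \{3,10,11\}, \{6,13\}, \{3,10,13\}$ 17. $\{1232\}$ : $2,9,13\ ;\ 14, 1, 6, \{7,12\}, \{11,5,4\}, \{3,11,8\}, \{8,12,4\}, \{3,8,12\}, \{3,10\}, \{11,8,4\}$ 18.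 $\{2312\}$ : $3,6,13\ ;\ 12, 2, 10, \{11,1,5\}, \{11,5,4\}, \{11,8\}, \{1,14,5\}, \{1,9\}, \{14,5,4\}, \{7,14,4\}$ 19. $\{2321\}$ : $4,7,12\ ;\ 2, 8, 14, \{11,10,1\}, \{11,5\}, \{10,1,13\}, \{3,6\}, \{1,9,13\}, \{3,10,11\}, \{3,10,13\}$ 20. $\{3121\}$ : $3,8,12\ ;\ 6, 11, 4, \{2,7\}, \{1,9,14\}, \{1,14,5\}, \{2,9,14\}, \{1,9,13\}, \{10,13\}, \{2,9,13\}$ 21. $\{12312\}$ : $2,6,13\ ;\ 12, 3, 9, \{11,1,5\}, \{7,14\}, \{11,5,4\}, \{10,1\}, \{1,14,5\}, \{14,5,4\}, \{11,8,4\}$ 22. $\{12321\}$ : $2,7,12\ ;\ 6, 14, 4, \{11,1,5\}, \{11,10,1\}, \{10,1,13\}, \{3,10,11\}, \{3,8\}, \{3,10,13\}, \{9,13\}$ 23. $\{23121\}$ : $3,6,12\ ;\ 2, 8, 13, \{11,1,5\}, \{11,5,4\}, \{1,9,14\}, \{1,14,5\}, \{10,11\}, \{7,4\}, \{14,5,4\}$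 24. $\{123121\}$ : $2,6,12\ ;\ 7, 3, 13, \{11,1,5\}, \{11,10,1\}, \{11,5,4\}, \{8,4\}, \{1,14,5\}, \{9,14\}, \{14,5,4\}$ 25. $\{e,1\}$ : $11,1,5,4\ ;\ 10, 14, 8, \{2,6,12\}, \{3,6,12\}, \{9,13\}, \{12,7\}, \{2,6,13\}, \{3,6,13\}$ 26. $\{e,2\}$ : $11,10,1,5\ ;\ 4, 13, 14, 3, \{2,7,12\}, \{2,6,12\}$ 27. $\{e,3\}$ : $11,1,14,5\ ;\ 10, 4, 9, \{2,6,12\}, \{2,7\}, \{3,6,12\}, \{3,8\}, \{2,6,13\}, \{3,6,13\}$ 28. $\{1,21\}$ : $11,8,5,4\ ;\ 1, 3, 12, 14, \{2,6,13\}, \{2,9,13\}$ 29. $\{1,31\}$ : $11,14,5,4\ ;\ 1, 7, 8, \{2,6,12\}, \{3,6,12\}, \{2,9\}, \{3,10\}, \{2,6,13\}, \{3,6,13\}$ 30. $\{2,12\}$ : $11,10,1,3\ ;\ 5, 13, 8, \{2,7,12\}, \{2,7,14\}, \{6,12\}, \{9,14\}, \{12,7,4\}, \{7,14,4\}$ 31.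 $\{2,32\}$ : $11,10,1,13\ ;\ 5, 9, 3, \{2,7,12\}, \{2,7,14\}, \{12,7,4\}, \{2,6\}, \{7,14,4\}, \{8,4\}$ 32. $\{3,23\}$ : $1,9,5,14\ ;\ 11, 2, 13, 4, \{3,6,12\}, \{3,8,12\}$ 33. $\{3,31\}$ : $1,14,5,4\ ;\ 11, 9, 7, \{2,6,12\}, \{10,13\}, \{3,6,12\}, \{8,12\}, \{2,6,13\}, \{3,6,13\}$ 34. $\{12,121\}$ : $3,11,8,10\ ;\ 1, 12, 13, 4, \{2,7,14\}, \{2,9,14\}$ 35. $\{12,312\}$ : $3,10,13,11\ ;\ 1, 8, 6, \{2,7,12\}, \{2,7,14\}, \{5,4\}, \{12,7,4\}, \{7,14,4\}, \{2,9\}$ 36. $\{21,121\}$ : $3,11,8,4\ ;\ 5, 12, 10, \{1,9,14\}, \{2,9,14\}, \{1,9,13\}, \{7,14\}, \{6,13\}, \{2,9,13\}$ 37. $\{21,321\}$ : $11,8,4,12\ ;\ 5, 3, 7, \{10,1\}, \{2,6\}, \{1,9,14\}, \{2,9,14\}, \{1,9,13\}, \{2,9,13\}$ 38. $\{23,123\}$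 : $2,1,9,14\ ;\ 7, 5, 13, \{11,10\}, \{6,12\}, \{3,11,8\}, \{8,12,4\}, \{3,8,12\}, \{11,8,4\}$ 39. $\{23,232\}$ : $1,9,13,14\ ;\ 10, 5, 2, \{3,11,8\}, \{8,12,4\}, \{3,8,12\}, \{7,4\}, \{3,6\}, \{11,8,4\}$ 40. $\{31,231\}$ : $7,14,5,4\ ;\ 2, 11, 1, 12, \{3,10,13\}, \{3,6,13\}$ 41. $\{32,232\}$ : $10,1,9,13\ ;\ 11, 14, 3, 2, \{8,12,4\}, \{12,7,4\}$ 42. $\{32,312\}$ : $3,10,1,13\ ;\ 11, 9, 6, \{2,7,12\}, \{2,7,14\}, \{14,5\}, \{12,7,4\}, \{8,12\}, \{7,14,4\}$ 43. $\{121,3121\}$ : $3,11,8,12\ ;\ 6, 4, 10, \{1,5\}, \{2,7\}, \{1,9,14\}, \{2,9,14\}, \{1,9,13\}, \{2,9,13\}$ 44. $\{123,1231\}$ : $2,9,7,14\ ;\ 12, 1, 4, 13, \{3,11,8\}, \{3,10,11\}$ 45. $\{123,1232\}$ : $2,9,14,13\ ;\ 7, 1, 6, \{3,11,8\}, \{8,12,4\},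 \{3,8,12\}, \{5,4\}, \{3,10\}, \{11,8,4\}$ 46. $\{231,1231\}$ : $2,7,14,4\ ;\ 12, 9, 5, \{11,10,1\}, \{10,1,13\}, \{3,10,11\}, \{6,13\}, \{3,10,13\}, \{11,8\}$ 47. $\{231,2321\}$ : $4,7,14,12\ ;\ 2, 8, 5, \{11,10,1\}, \{10,1,13\}, \{3,6\}, \{1,9\}, \{3,10,11\}, \{3,10,13\}$ 48. $\{232,1232\}$ : $2,1,9,13\ ;\ 10, 14, 6, \{11,5\}, \{7,12\}, \{3,11,8\}, \{8,12,4\}, \{3,8,12\}, \{11,8,4\}$ 49. $\{312,2312\}$ : $3,10,6,13\ ;\ 1, 12, 11, 2, \{14,5,4\}, \{7,14,4\}$ 50. $\{321,2321\}$ : $7,8,4,12\ ;\ 2, 3, 14, 11, \{10,1,13\}, \{1,9,13\}$ 51. $\{321,3121\}$ : $3,8,4,12\ ;\ 6, 11, 7, \{1,9,14\}, \{2,9,14\}, \{1,9,13\}, \{14,5\}, \{10,13\}, \{2,9,13\}$ 52. $\{1231,12321\}$ : $2,7,14,12\ ;\ 6, 9, 4, \{11,10,1\}, \{10,1,13\},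 \{1,5\}, \{3,10,11\}, \{3,8\}, \{3,10,13\}$ 53. $\{1232,12312\}$ : $2,9,6,13\ ;\ 12, 14, 1, 3, \{11,5,4\}, \{11,8,4\}$ 54. $\{2312,12312\}$ : $3,2,6,13\ ;\ 12, 10, 9, \{11,1,5\}, \{7,14\}, \{11,5,4\}, \{11,8\}, \{1,14,5\}, \{14,5,4\}$ 55. $\{2312,23121\}$ : $3,6,13,12\ ;\ 2, 8, 10, \{11,1,5\}, \{11,5,4\}, \{1,14,5\}, \{1,9\}, \{7,4\}, \{14,5,4\}$ 56. $\{2321,12321\}$ : $2,4,7,12\ ;\ 6, 14, 8, \{11,10,1\}, \{11,5\}, \{10,1,13\}, \{3,10,11\}, \{3,10,13\}, \{9,13\}$ 57. $\{3121,23121\}$ : $3,8,6,12\ ;\ 2, 11, 4, 13, \{1,9,14\}, \{1,14,5\}$ 58. $\{12312,123121\}$ : $2,6,13,12\ ;\ 7, 3, 9, \{11,1,5\}, \{11,5,4\}, \{10,1\}, \{8,4\}, \{1,14,5\}, \{14,5,4\}$ 59. $\{12321,123121\}$ : $2,7,6,12\ ;\ 14, 3, 4, 13, \{11,1,5\}, \{11,10,1\}$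 60. $\{23121,123121\}$ : $3,2,6,12\ ;\ 7, 8, 13, \{11,1,5\}, \{11,5,4\}, \{1,14,5\}, \{9,14\}, \{10,11\}, \{14,5,4\}$ 61. $\{e,1,2\}$ : $11,10,1,5,4\ ;\ 13, 14, 3, 8, \{2,6,12\}, \{12,7\}$ 62. $\{e,1,21\}$ : $11,1,8,5,4\ ;\ 10, 3, 12, 14, \{9,13\}, \{2,6,13\}$ 63. $\{e,2,3\}$ : $11,10,1,14,5\ ;\ 4, 13, 9, 3, \{2,6,12\}, \{2,7\}$ 64. $\{e,2,12\}$ : $11,10,1,3,5\ ;\ 4, 13, 8, 14, \{2,7,12\}, \{6,12\}$ 65. $\{e,2,32\}$ : $11,10,1,13,5\ ;\ 4, 14, 9, 3, \{2,7,12\}, \{2,6\}$ 66. $\{e,3,23\}$ : $11,1,9,5,14\ ;\ 10, 4, 2, 13, \{3,6,12\}, \{3,8\}$ 67. $\{1,21,31\}$ : $11,8,14,5,4\ ;\ 1, 3, 12, 7, \{2,9\}, \{2,6,13\}$ 68. $\{1,21,121\}$ : $11,3,8,5,4\ ;\ 1, 12, 10, 14, \{6,13\}, \{2,9,13\}$ 69.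 $\{1,21,321\}$ : $11,8,12,5,4\ ;\ 1, 3, 7, 14, \{2,6\}, \{2,9,13\}$ 70. $\{1,31,231\}$ : $11,7,14,5,4\ ;\ 1, 2, 12, 8, \{3,10\}, \{3,6,13\}$ 71. $\{2,12,121\}$ : $11,10,1,8,3\ ;\ 5, 13, 12, 4, \{2,7,14\}, \{9,14\}$ 72. $\{2,32,232\}$ : $11,10,1,9,13\ ;\ 5, 14, 3, 2, \{12,7,4\}, \{8,4\}$ 73. $\{3,23,31\}$ : $1,4,9,5,14\ ;\ 11, 2, 13, 7, \{3,6,12\}, \{8,12\}$ 74. $\{3,23,123\}$ : $2,1,9,5,14\ ;\ 11, 7, 13, 4, \{6,12\}, \{3,8,12\}$ 75. $\{3,23,232\}$ : $1,13,9,5,14\ ;\ 11, 10, 2, 4, \{3,8,12\}, \{3,6\}$ 76. $\{3,31,231\}$ : $1,7,14,5,4\ ;\ 11, 2, 9, 12, \{10,13\}, \{3,6,13\}$ 77. $\{12,21,121\}$ : $3,11,8,4,10\ ;\ 1, 5, 12, 13, \{2,9,14\}, \{7,14\}$ 78. $\{12,121,312\}$ : $3,11,8,13,10\ ;\ 1,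 12, 6, 4, \{2,7,14\}, \{2,9\}$ 79. $\{12,121,3121\}$ : $3,11,8,12,10\ ;\ 1, 6, 4, 13, \{2,7\}, \{2,9,14\}$ 80. $\{12,312,2312\}$ : $3,10,13,11,6\ ;\ 1, 12, 8, 2, \{5,4\}, \{7,14,4\}$ 81. $\{21,321,2321\}$ : $11,7,8,4,12\ ;\ 2, 5, 3, 14, \{10,1\}, \{1,9,13\}$ 82. $\{23,32,232\}$ : $10,1,9,13,14\ ;\ 11, 5, 2, 3, \{8,12,4\}, \{7,4\}$ 83. $\{23,123,1231\}$ : $9,2,1,7,14\ ;\ 12, 5, 13, 4, \{11,10\}, \{3,11,8\}$ 84. $\{31,231,1231\}$ : $2,7,14,5,4\ ;\ 12, 11, 1, 9, \{6,13\}, \{3,10,13\}$ 85. $\{31,231,2321\}$ : $4,7,14,5,12\ ;\ 2, 11, 8, 1, \{3,6\}, \{3,10,13\}$ 86. $\{32,232,312\}$ : $3,10,1,9,13\ ;\ 11, 14, 6, 2, \{12,7,4\}, \{8,12\}$ 87. $\{32,232,1232\}$ : $10,1,9,13,2\ ;\ 11, 14, 6, 3, \{7,12\}, \{8,12,4\}$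 88. $\{32,312,2312\}$ : $3,10,1,6,13\ ;\ 11, 12, 9, 2, \{14,5\}, \{7,14,4\}$ 89. $\{121,3121,23121\}$ : $3,11,8,6,12\ ;\ 2, 4, 10, 13, \{1,5\}, \{1,9,14\}$ 90. $\{123,231,1231\}$ : $2,9,7,14,4\ ;\ 12, 1, 5, 13, \{3,10,11\}, \{11,8\}$ 91. $\{123,1231,1232\}$ : $2,9,7,14,13\ ;\ 12, 1, 6, 4, \{3,11,8\}, \{3,10\}$ 92. $\{123,1231,12321\}$ : $2,9,7,14,12\ ;\ 6, 1, 4, 13, \{3,10,11\}, \{3,8\}$ 93. $\{123,1232,12312\}$ : $2,9,14,13,6\ ;\ 12, 7, 1, 3, \{5,4\}, \{11,8,4\}$ 94. $\{231,321,2321\}$ : $7,8,4,14,12\ ;\ 2, 3, 5, 11, \{10,1,13\}, \{1,9\}$ 95. $\{232,1232,12312\}$ : $2,1,9,13,6\ ;\ 12, 10, 14, 3, \{11,5\}, \{11,8,4\}$ 96. $\{312,2312,12312\}$ : $3,2,6,13,10\ ;\ 12, 1, 11, 9, \{7,14\}, \{14,5,4\}$ 97. $\{312,2312,23121\}$ :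 $3,10,6,13,12\ ;\ 2, 1, 11, 8, \{7,4\}, \{14,5,4\}$ 98. $\{321,2321,3121\}$ : $3,7,8,4,12\ ;\ 2, 6, 11, 14, \{1,9,13\}, \{10,13\}$ 99. $\{321,2321,12321\}$ : $4,2,8,7,12\ ;\ 6, 14, 3, 11, \{10,1,13\}, \{9,13\}$ 100. $\{321,3121,23121\}$ : $3,8,4,6,12\ ;\ 2, 11, 7, 13, \{1,9,14\}, \{14,5\}$ 101. $\{1231,12321,123121\}$ : $14,2,7,6,12\ ;\ 3, 9, 4, 13, \{11,10,1\}, \{1,5\}$ 102. $\{1232,2312,12312\}$ : $3,2,9,6,13\ ;\ 12, 14, 1, 10, \{11,5,4\}, \{11,8\}$ 103. $\{1232,12312,123121\}$ : $2,9,6,13,12\ ;\ 7, 3, 14, 1, \{11,5,4\}, \{8,4\}$ 104. $\{2312,3121,23121\}$ : $3,8,6,13,12\ ;\ 2, 11, 4, 10, \{1,14,5\}, \{1,9\}$ 105. $\{2321,12321,123121\}$ : $2,4,7,6,12\ ;\ 14, 3, 8, 13, \{11,10,1\}, \{11,5\}$ 106. $\{3121,23121,123121\}$ : $3,2,8,6,12\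 ;\ 7, 11, 4, 13, \{1,14,5\}, \{9,14\}$ 107. $\{12312,12321,123121\}$ : $2,7,6,13,12\ ;\ 14, 3, 4, 9, \{11,1,5\}, \{10,1\}$ 108. $\{12321,23121,123121\}$ : $3,2,7,6,12\ ;\ 14, 4, 8, 13, \{11,1,5\}, \{10,11\}$ 109. $\{e,1,2,21\}$ : $1,8,4,11,10,5\ ;\ 13, 3, 12, 14$ 110. $\{e,1,3,31\}$ : $11,1,14,5,4\ ;\ 10, 9, 7, 8, \{2,6,12\}, \{3,6,12\}, \{2,6,13\}, \{3,6,13\}$ 111. $\{e,2,3,23\}$ : $1,11,14,10,9,5\ ;\ 4, 13, 2, 3$ 112. $\{e,2,12,121\}$ : $1,8,11,3,10,5\ ;\ 4, 13, 14, 12$ 113. $\{e,2,32,232\}$ : $1,11,10,13,9,5\ ;\ 4, 14, 3, 2$ 114. $\{1,12,21,121\}$ : $8,4,11,3,10,5\ ;\ 1, 12, 14, 13$ 115. $\{1,21,31,231\}$ : $8,4,11,7,14,5\ ;\ 1, 2, 3, 12$ 116. $\{1,21,321,2321\}$ : $8,4,11,7,5,12\ ;\ 1, 2, 3, 14$ 117.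 $\{2,12,32,312\}$ : $11,10,1,3,13\ ;\ 5, 8, 9, 6, \{2,7,12\}, \{2,7,14\}, \{12,7,4\}, \{7,14,4\}$ 118. $\{3,23,31,231\}$ : $1,4,7,14,9,5\ ;\ 11, 2, 13, 12$ 119. $\{3,23,32,232\}$ : $1,14,10,13,9,5\ ;\ 11, 2, 4, 3$ 120. $\{3,23,123,1231\}$ : $1,7,14,2,9,5\ ;\ 11, 12, 13, 4$ 121. $\{12,121,312,2312\}$ : $8,11,3,10,6,13\ ;\ 1, 12, 2, 4$ 122. $\{12,121,3121,23121\}$ : $8,11,3,10,6,12\ ;\ 1, 2, 4, 13$ 123. $\{21,121,321,3121\}$ : $3,11,8,4,12\ ;\ 5, 6, 10, 7, \{1,9,14\}, \{2,9,14\}, \{1,9,13\}, \{2,9,13\}$ 124. $\{23,123,232,1232\}$ : $2,1,9,13,14\ ;\ 7, 10, 5, 6, \{3,11,8\}, \{8,12,4\}, \{3,8,12\}, \{11,8,4\}$ 125. $\{31,123,231,1231\}$ : $4,7,14,2,9,5\ ;\ 12, 11, 1, 13$ 126. $\{31,231,321,2321\}$ : $8,4,7,14,5,12\ ;\ 2,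 11, 1, 3$ 127. $\{32,232,312,2312\}$ : $1,3,10,6,13,9\ ;\ 11, 12, 14, 2$ 128. $\{32,232,1232,12312\}$ : $1,10,6,13,2,9\ ;\ 11, 12, 14, 3$ 129. $\{123,1231,1232,12312\}$ : $7,14,6,13,2,9\ ;\ 12, 1, 4, 3$ 130. $\{123,1231,12321,123121\}$ : $7,14,6,2,9,12\ ;\ 3, 1, 4, 13$ 131. $\{231,1231,2321,12321\}$ : $2,4,7,14,12\ ;\ 6, 8, 9, 5, \{11,10,1\}, \{10,1,13\}, \{3,10,11\}, \{3,10,13\}$ 132. $\{312,1232,2312,12312\}$ : $3,10,6,13,2,9\ ;\ 12, 1, 14, 11$ 133. $\{312,2312,3121,23121\}$ : $8,3,10,6,13,12\ ;\ 2, 1, 11, 4$ 134. $\{321,2321,3121,23121\}$ : $8,4,7,3,6,12\ ;\ 2, 11, 14, 13$ 135. $\{321,2321,12321,123121\}$ : $8,4,7,6,2,12\ ;\ 14, 3, 13, 11$ 136. $\{1232,12312,12321,123121\}$ : $7,6,13,2,9,12\ ;\ 14, 3, 1, 4$ 137. $\{2312,12312,23121,123121\}$ : $3,2,6,13,12\ ;\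 7, 8, 10, 9, \{11,1,5\}, \{11,5,4\}, \{1,14,5\}, \{14,5,4\}$ 138. $\{3121,12321,23121,123121\}$ : $8,7,3,6,2,12\ ;\ 14, 11, 4, 13$ 139. $\{e,1,2,3,31\}$ : $1,4,11,14,10,5\ ;\ 13, 9, 3, 7, 8, \{2,6,12\}$ 140. $\{e,1,3,21,31\}$ : $1,8,4,11,14,5\ ;\ 10, 3, 12, 9, 7, \{2,6,13\}$ 141. $\{e,1,3,23,31\}$ : $1,4,11,14,9,5\ ;\ 10, 2, 13, 7, 8, \{3,6,12\}$ 142. $\{e,1,3,31,231\}$ : $1,4,11,7,14,5\ ;\ 10, 2, 9, 12, 8, \{3,6,13\}$ 143. $\{e,2,12,32,312\}$ : $1,11,3,10,13,5\ ;\ 4, 8, 14, 9, 6, \{2,7,12\}$ 144. $\{1,21,121,321,3121\}$ : $8,4,11,3,5,12\ ;\ 1, 6, 10, 7, 14, \{2,9,13\}$ 145. $\{2,12,32,121,312\}$ : $1,8,11,3,10,13\ ;\ 5, 9, 12, 6, 4, \{2,7,14\}$ 146. $\{2,12,32,232,312\}$ : $1,11,3,10,13,9\ ;\ 5, 8, 14,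 6, 2, \{12,7,4\}$ 147. $\{2,12,32,312,2312\}$ : $1,11,3,10,6,13\ ;\ 5, 12, 8, 9, 2, \{7,14,4\}$ 148. $\{3,23,123,232,1232\}$ : $1,14,13,2,9,5\ ;\ 11, 7, 10, 4, 6, \{3,8,12\}$ 149. $\{12,21,121,321,3121\}$ : $8,4,11,3,10,12\ ;\ 1, 5, 6, 7, 13, \{2,9,14\}$ 150. $\{21,121,321,2321,3121\}$ : $8,4,11,7,3,12\ ;\ 2, 5, 6, 10, 14, \{1,9,13\}$ 151. $\{21,121,321,3121,23121\}$ : $8,4,11,3,6,12\ ;\ 2, 5, 10, 7, 13, \{1,9,14\}$ 152. $\{23,32,123,232,1232\}$ : $1,14,10,13,2,9\ ;\ 11, 7, 5, 6, 3, \{8,12,4\}$ 153. $\{23,123,232,1231,1232\}$ : $1,7,14,13,2,9\ ;\ 12, 10, 5, 6, 4, \{3,11,8\}$ 154. $\{23,123,232,1232,12312\}$ : $1,14,6,13,2,9\ ;\ 12, 7, 10, 5, 3, \{11,8,4\}$ 155. $\{31,231,1231,2321,12321\}$ : $4,7,14,2,5,12\ ;\ 6, 11, 8, 1, 9, \{3,10,13\}$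 156. $\{123,231,1231,2321,12321\}$ : $4,7,14,2,9,12\ ;\ 6, 8, 1, 5, 13, \{3,10,11\}$ 157. $\{231,321,1231,2321,12321\}$ : $8,4,7,14,2,12\ ;\ 6, 9, 3, 5, 11, \{10,1,13\}$ 158. $\{231,1231,2321,12321,123121\}$ : $4,7,14,6,2,12\ ;\ 3, 8, 9, 5, 13, \{11,10,1\}$ 159. $\{312,2312,12312,23121,123121\}$ : $3,10,6,13,2,12\ ;\ 7, 1, 11, 8, 9, \{14,5,4\}$ 160. $\{1232,2312,12312,23121,123121\}$ : $3,6,13,2,9,12\ ;\ 7, 14, 1, 8, 10, \{11,5,4\}$ 161. $\{2312,3121,12312,23121,123121\}$ : $8,3,6,13,2,12\ ;\ 7, 11, 4, 10, 9, \{1,14,5\}$ 162. $\{2312,12312,12321,23121,123121\}$ : $7,3,6,13,2,12\ ;\ 14, 4, 8, 10, 9, \{11,1,5\}$ 163. $\{e,1,2,3,21,31\}$ : $1,8,4,11,14,10,5\ ;\ 13, 3, 12, 9, 7$ 164. $\{e,1,2,3,23,31\}$ : $1,4,11,14,10,9,5\ ;\ 13, 2, 3, 7, 8$ 165. $\{e,1,2,12,21,121\}$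 : $1,8,4,11,3,10,5\ ;\ 13, 12, 14$ 166. $\{e,1,3,21,31,231\}$ : $1,8,4,11,7,14,5\ ;\ 10, 2, 3, 12, 9$ 167. $\{e,1,3,23,31,231\}$ : $1,4,11,7,14,9,5\ ;\ 10, 2, 13, 12, 8$ 168. $\{e,2,3,23,32,232\}$ : $1,11,14,10,13,9,5\ ;\ 4, 2, 3$ 169. $\{e,2,12,32,121,312\}$ : $1,8,11,3,10,13,5\ ;\ 4, 14, 9, 12, 6$ 170. $\{e,2,12,32,232,312\}$ : $1,11,3,10,13,9,5\ ;\ 4, 8, 14, 6, 2$ 171. $\{1,12,21,121,321,3121\}$ : $8,4,11,3,10,5,12\ ;\ 1, 6, 7, 14, 13$ 172. $\{1,21,31,231,321,2321\}$ : $8,4,11,7,14,5,12\ ;\ 1, 2, 3$ 173. $\{1,21,121,321,2321,3121\}$ : $8,4,11,7,3,5,12\ ;\ 1, 2, 6, 10, 14$ 174. $\{2,12,32,121,312,2312\}$ : $1,8,11,3,10,6,13\ ;\ 5, 12, 9, 2, 4$ 175. $\{2,12,32,232,312,2312\}$ : $1,11,3,10,6,13,9\ ;\ 5, 12, 8, 14,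 2$ 176. $\{3,23,31,123,231,1231\}$ : $1,4,7,14,2,9,5\ ;\ 11, 12, 13$ 177. $\{3,23,32,123,232,1232\}$ : $1,14,10,13,2,9,5\ ;\ 11, 7, 4, 6, 3$ 178. $\{3,23,123,232,1231,1232\}$ : $1,7,14,13,2,9,5\ ;\ 11, 12, 10, 4, 6$ 179. $\{12,21,121,321,3121,23121\}$ : $8,4,11,3,10,6,12\ ;\ 1, 2, 5, 7, 13$ 180. $\{12,121,312,2312,3121,23121\}$ : $8,11,3,10,6,13,12\ ;\ 1, 2, 4$ 181. $\{21,121,321,2321,3121,23121\}$ : $8,4,11,7,3,6,12\ ;\ 2, 5, 10, 14, 13$ 182. $\{23,32,123,232,1232,12312\}$ : $1,14,10,6,13,2,9\ ;\ 11, 12, 7, 5, 3$ 183. $\{23,123,232,1231,1232,12312\}$ : $1,7,14,6,13,2,9\ ;\ 12, 10, 5, 4, 3$ 184. $\{31,123,231,1231,2321,12321\}$ : $4,7,14,2,9,5,12\ ;\ 6, 11, 8, 1, 13$ 185. $\{31,231,321,1231,2321,12321\}$ : $8,4,7,14,2,5,12\ ;\ 6, 11, 1, 9, 3$ 186. $\{32,232,312,1232,2312,12312\}$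 : $1,3,10,6,13,2,9\ ;\ 11, 12, 14$ 187. $\{123,231,1231,2321,12321,123121\}$ : $4,7,14,6,2,9,12\ ;\ 3, 8, 1, 5, 13$ 188. $\{123,1231,1232,12312,12321,123121\}$ : $7,14,6,13,2,9,12\ ;\ 3, 1, 4$ 189. $\{231,321,1231,2321,12321,123121\}$ : $8,4,7,14,6,2,12\ ;\ 3, 9, 5, 13, 11$ 190. $\{312,1232,2312,12312,23121,123121\}$ : $3,10,6,13,2,9,12\ ;\ 7, 1, 14, 11, 8$ 191. $\{312,2312,3121,12312,23121,123121\}$ : $8,3,10,6,13,2,12\ ;\ 7, 1, 11, 4, 9$ 192. $\{321,2321,3121,12321,23121,123121\}$ : $8,4,7,3,6,2,12\ ;\ 14, 11, 13$ 193. $\{1232,2312,12312,12321,23121,123121\}$ : $7,3,6,13,2,9,12\ ;\ 14, 1, 4, 8, 10$ 194. $\{2312,3121,12312,12321,23121,123121\}$ : $8,7,3,6,13,2,12\ ;\ 14, 11, 4, 10, 9$ -/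

import Mathlib

noncomputable section

namespace SL4

/-- The ambient Euclidean space `ℝ⁴`. -/
abbrev V := EuclideanSpace ℝ (Fin 4)

/-- The simple roots `α_{i+1} = e_{i+1} - e_{i+2}` of `𝔰𝔩₄(ℂ)`; so `α 0`, `α 1`, `α 2` are the
usual `α₁`, `α₂`, `α₃`. -/
def α (i : Fin 3) : V :=
  EuclideanSpace.single i.castSucc 1 - EuclideanSpace.single i.succ 1

open Classical in
/-- The six positive roots. -/
def posRoots : Finset V :=
  {α 0, α 1, α 2, α 0 + α 1, α 1 + α 2, α 0 + α 1 + α 2}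

/-- Half the sum of the positive roots. -/
def ρ : V := (1 / 2 : ℝ) • ∑ β ∈ posRoots, β

/-- The fundamental weights, written in the basis of simple roots; `ϖ 0`, `ϖ 1`, `ϖ 2` are the
usual `ϖ₁`, `ϖ₂`, `ϖ₃`. -/
def ϖ : Fin 3 → V
  | 0 => (1 / 4 : ℝ) • ((3 : ℝ) • α 0 + (2 : ℝ) • α 1 + α 2)
  | 1 => (1 / 2 : ℝ) • (α 0 + (2 : ℝ) • α 1 + α 2)
  | 2 => (1 / 4 : ℝ) • (α 0 + (2 : ℝ) • α 1 + (3 : ℝ) • α 2)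

/-- The integral weight `m ϖ₁ + n ϖ₂ + k ϖ₃`. -/
def weight (m n k : ℤ) : V := (m : ℝ) • ϖ 0 + (n : ℝ) • ϖ 1 + (k : ℝ) • ϖ 2

/-- The Weyl group, generated by the orthogonal reflections in the hyperplanes orthogonal to the
simple roots. -/
def weylGroup : Subgroup (V ≃ₗᵢ[ℝ] V) :=
  Subgroup.closure (Set.range fun i : Fin 3 => (Submodule.span ℝ {α i})ᗮ.reflection)

/-- The simple reflections; `s 0`, `s 1`, `s 2` are the usual `s₁`, `s₂`, `s₃`. -/
def s (i : Fin 3) : weylGroup :=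
  ⟨(Submodule.span ℝ {α i})ᗮ.reflection, Subgroup.subset_closure ⟨i, rfl⟩⟩

/-- Kostant's partition function: the number of ways of writing `ξ` as a sum of positive roots
with nonnegative integral multiplicities. The count is taken in `ℕ∞`, so that no convention about
infinite sets enters. -/
def kostant (ξ : V) : ℕ∞ :=
  Set.encard {f : posRoots → ℕ | ∑ β : posRoots, f β • (β : V) = ξ}

/-- The Weyl alternation set `𝒜(λ, μ)`. -/
def altSet (lam μ : V) : Set weylGroup :=
  {σ | 0 < kostant ((σ : V ≃ₗᵢ[ℝ] V) (lam + ρ) - (μ + ρ))}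

/-- Names for 24 words in the simple reflections: `s123` stands for `s₁s₂s₃`, and `e` for the
empty word. -/
inductive Word
  | e | s1 | s2 | s3 | s12 | s21 | s23 | s31 | s32 | s121 | s123 | s231 | s232 | s312 | s321
  | s1231 | s1232 | s2312 | s2321 | s3121 | s12312 | s12321 | s23121 | s123121
  deriving DecidableEq

/-- The element of the Weyl group that a word represents. -/
def Word.elt : Word → weylGroup
  | .e => 1
  | .s1 => s 0
  | .s2 => s 1
  | .s3 => s 2
  | .s12 => s 0 * s 1
  | .s21 => s 1 * s 0
  | .s23 => s 1 * s 2
  | .s31 => s 2 * s 0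
  | .s32 => s 2 * s 1
  | .s121 => s 0 * s 1 * s 0
  | .s123 => s 0 * s 1 * s 2
  | .s231 => s 1 * s 2 * s 0
  | .s232 => s 1 * s 2 * s 1
  | .s312 => s 2 * s 0 * s 1
  | .s321 => s 2 * s 1 * s 0
  | .s1231 => s 0 * s 1 * s 2 * s 0
  | .s1232 => s 0 * s 1 * s 2 * s 1
  | .s2312 => s 1 * s 2 * s 0 * s 1
  | .s2321 => s 1 * s 2 * s 1 * s 0
  | .s3121 => s 2 * s 0 * s 1 * s 0
  | .s12312 => s 0 * s 1 * s 2 * s 0 * s 1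
  | .s12321 => s 0 * s 1 * s 2 * s 1 * s 0
  | .s23121 => s 1 * s 2 * s 0 * s 1 * s 0
  | .s123121 => s 0 * s 1 * s 2 * s 0 * s 1 * s 0

/-- Labels for the fourteen linear forms that occur as coefficients of simple roots. -/
inductive Label
  | K1 | K2 | K3 | K4 | K5 | K6 | K7 | K8 | K9 | K10 | K11 | K12 | K13 | K14
  deriving DecidableEq

/-- The linear form with a given label: `K1`–`K4` are coefficients of `α₁`, `K5`–`K10`
coefficients of `α₂`, and `K11`–`K14` coefficients of `α₃`. -/
def Label.form (c₁ c₂ c₃ : ℕ) (x y z : ℤ) : Label → ℤ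
  | .K1 => x
  | .K2 => -c₁ - c₂ - c₃ - z - 3
  | .K3 => -c₁ - c₂ - y + z - 2
  | .K4 => -c₁ - x + y - 1
  | .K5 => y
  | .K6 => -c₁ - 2 * c₂ - c₃ - y - 4
  | .K7 => -c₁ - c₂ - c₃ - x + y - z - 3
  | .K8 => -c₁ - c₂ - x + z - 2
  | .K9 => -c₂ - c₃ + x - z - 2
  | .K10 => -c₂ + x - y + z - 1
  | .K11 => z
  | .K12 => -c₁ - c₂ - c₃ - x - 3
  | .K13 => -c₂ - c₃ + x - y - 2
  | .K14 => -c₃ + y - z - 1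

/-- The condition that the form with the given label takes a nonnegative value. -/
def Label.Holds (c₁ c₂ c₃ : ℕ) (x y z : ℤ) (k : Label) : Prop := 0 ≤ k.form c₁ c₂ c₃ x y z

/-- For each word, the labels of the coefficients of `α₁`, `α₂`, `α₃` in `σ(λ + ρ) - ρ - μ`. -/
def Word.coeffs : Word → Label × Label × Label
  | .e => (.K1, .K5, .K11)
  | .s1 => (.K4, .K5, .K11)
  | .s2 => (.K1, .K10, .K11)
  | .s3 => (.K1, .K5, .K14)
  | .s12 => (.K3, .K10, .K11)
  | .s21 => (.K4, .K8, .K11)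
  | .s23 => (.K1, .K9, .K14)
  | .s31 => (.K4, .K5, .K14)
  | .s32 => (.K1, .K10, .K13)
  | .s121 => (.K3, .K8, .K11)
  | .s123 => (.K2, .K9, .K14)
  | .s231 => (.K4, .K7, .K14)
  | .s232 => (.K1, .K9, .K13)
  | .s312 => (.K3, .K10, .K13)
  | .s321 => (.K4, .K8, .K12)
  | .s1231 => (.K2, .K7, .K14)
  | .s1232 => (.K2, .K9, .K13)
  | .s2312 => (.K3, .K6, .K13)
  | .s2321 => (.K4, .K7, .K12)
  | .s3121 => (.K3, .K8, .K12)
  | .s12312 => (.K2, .K6, .K13)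
  | .s12321 => (.K2, .K7, .K12)
  | .s23121 => (.K3, .K6, .K12)
  | .s123121 => (.K2, .K6, .K12)

/-- A row of the classification: a set of Weyl group elements (given by words), together with
labels `pos` whose conditions are required to hold, and a list `neg` of disjunctions of negated
conditions. -/
structure Row where
  words : List Word
  pos : List Label
  neg : List (List Label)

/-- The subset of the Weyl group listed in a row. -/
def Row.carrier (r : Row) : Set weylGroup := {σ | ∃ w ∈ r.words, w.elt = σ}

/-- The linear conditions of a row: every `K` in `pos` holds, and for every member of `neg` one of
its entries fails. -/
def Row.Cond (c₁ c₂ c₃ : ℕ) (x y z : ℤ) (r : Row) : Prop :=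
  (∀ k ∈ r.pos, k.Holds c₁ c₂ c₃ x y z) ∧
    ∀ d ∈ r.neg, ∃ k ∈ d, ¬ k.Holds c₁ c₂ c₃ x y z

open Word Label in
/-- The explicit list of the 194 nonempty Weyl alternation sets with their conditions. -/
def rows : List Row := [
  ⟨[e], [K11,K1,K5], [[K10],[K4],[K14],[K2,K7,K12],[K2,K6,K12],[K3,K6,K12],[K3,K8],[K9,K13],[K2,K6,K13],[K3,K6,K13]]⟩,
  ⟨[s1], [K11,K5,K4], [[K1],[K14],[K8],[K2,K6,K12],[K3,K6,K12],[K3,K10],[K12,K7],[K2,K6,K13],[K3,K6,K13],[K2,K9,K13]]⟩,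
  ⟨[s2], [K11,K10,K1], [[K5],[K13],[K3],[K2,K7,K12],[K2,K6,K12],[K2,K7,K14],[K9,K14],[K12,K7,K4],[K7,K14,K4],[K8,K4]]⟩,
  ⟨[s3], [K1,K14,K5], [[K11],[K9],[K4],[K2,K6,K12],[K2,K7],[K10,K13],[K3,K6,K12],[K3,K8,K12],[K2,K6,K13],[K3,K6,K13]]⟩,
  ⟨[s12], [K3,K10,K11], [[K1],[K8],[K13],[K2,K7,K12],[K2,K7,K14],[K5,K4],[K6,K12],[K2,K9,K14],[K12,K7,K4],[K7,K14,K4]]⟩,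
  ⟨[s21], [K11,K8,K4], [[K5],[K3],[K12],[K10,K1],[K1,K9,K14],[K2,K9,K14],[K1,K9,K13],[K2,K6,K13],[K7,K14],[K2,K9,K13]]⟩,
  ⟨[s23], [K1,K9,K14], [[K5],[K2],[K13],[K11,K10],[K3,K6,K12],[K3,K11,K8],[K8,K12,K4],[K3,K8,K12],[K7,K4],[K11,K8,K4]]⟩,
  ⟨[s31], [K14,K5,K4], [[K11],[K1],[K7],[K2,K6,K12],[K3,K6,K12],[K8,K12],[K2,K9],[K2,K6,K13],[K3,K10,K13],[K3,K6,K13]]⟩,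
  ⟨[s32], [K10,K1,K13], [[K11],[K9],[K3],[K2,K7,K12],[K2,K7,K14],[K8,K12,K4],[K14,K5],[K12,K7,K4],[K2,K6],[K7,K14,K4]]⟩,
  ⟨[s121], [K3,K11,K8], [[K10],[K12],[K4],[K1,K5],[K2,K7,K14],[K1,K9,K14],[K2,K9,K14],[K1,K9,K13],[K6,K13],[K2,K9,K13]]⟩,
  ⟨[s123], [K2,K9,K14], [[K7],[K1],[K13],[K6,K12],[K3,K11,K8],[K8,K12,K4],[K3,K10,K11],[K3,K8,K12],[K5,K4],[K11,K8,K4]]⟩,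
  ⟨[s231], [K7,K14,K4], [[K2],[K12],[K5],[K11,K10,K1],[K10,K1,K13],[K1,K9],[K3,K10,K11],[K3,K10,K13],[K3,K6,K13],[K11,K8]]⟩,
  ⟨[s232], [K1,K9,K13], [[K10],[K14],[K2],[K11,K5],[K3,K11,K8],[K8,K12,K4],[K12,K7,K4],[K3,K8,K12],[K3,K6],[K11,K8,K4]]⟩,
  ⟨[s312], [K3,K10,K13], [[K1],[K11],[K6],[K2,K7,K12],[K2,K7,K14],[K12,K7,K4],[K8,K12],[K14,K5,K4],[K7,K14,K4],[K2,K9]]⟩,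
  ⟨[s321], [K8,K4,K12], [[K7],[K3],[K11],[K2,K6],[K10,K1,K13],[K1,K9,K14],[K2,K9,K14],[K1,K9,K13],[K14,K5],[K2,K9,K13]]⟩,
  ⟨[s1231], [K2,K7,K14], [[K12],[K9],[K4],[K11,K10,K1],[K10,K1,K13],[K3,K11,K8],[K1,K5],[K3,K10,K11],[K6,K13],[K3,K10,K13]]⟩,
  ⟨[s1232], [K2,K9,K13], [[K14],[K1],[K6],[K7,K12],[K11,K5,K4],[K3,K11,K8],[K8,K12,K4],[K3,K8,K12],[K3,K10],[K11,K8,K4]]⟩,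
  ⟨[s2312], [K3,K6,K13], [[K12],[K2],[K10],[K11,K1,K5],[K11,K5,K4],[K11,K8],[K1,K14,K5],[K1,K9],[K14,K5,K4],[K7,K14,K4]]⟩,
  ⟨[s2321], [K4,K7,K12], [[K2],[K8],[K14],[K11,K10,K1],[K11,K5],[K10,K1,K13],[K3,K6],[K1,K9,K13],[K3,K10,K11],[K3,K10,K13]]⟩,
  ⟨[s3121], [K3,K8,K12], [[K6],[K11],[K4],[K2,K7],[K1,K9,K14],[K1,K14,K5],[K2,K9,K14],[K1,K9,K13],[K10,K13],[K2,K9,K13]]⟩,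
  ⟨[s12312], [K2,K6,K13], [[K12],[K3],[K9],[K11,K1,K5],[K7,K14],[K11,K5,K4],[K10,K1],[K1,K14,K5],[K14,K5,K4],[K11,K8,K4]]⟩,
  ⟨[s12321], [K2,K7,K12], [[K6],[K14],[K4],[K11,K1,K5],[K11,K10,K1],[K10,K1,K13],[K3,K10,K11],[K3,K8],[K3,K10,K13],[K9,K13]]⟩,
  ⟨[s23121], [K3,K6,K12], [[K2],[K8],[K13],[K11,K1,K5],[K11,K5,K4],[K1,K9,K14],[K1,K14,K5],[K10,K11],[K7,K4],[K14,K5,K4]]⟩,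
  ⟨[s123121], [K2,K6,K12], [[K7],[K3],[K13],[K11,K1,K5],[K11,K10,K1],[K11,K5,K4],[K8,K4],[K1,K14,K5],[K9,K14],[K14,K5,K4]]⟩,
  ⟨[e,s1], [K11,K1,K5,K4], [[K10],[K14],[K8],[K2,K6,K12],[K3,K6,K12],[K9,K13],[K12,K7],[K2,K6,K13],[K3,K6,K13]]⟩,
  ⟨[e,s2], [K11,K10,K1,K5], [[K4],[K13],[K14],[K3],[K2,K7,K12],[K2,K6,K12]]⟩,
  ⟨[e,s3], [K11,K1,K14,K5], [[K10],[K4],[K9],[K2,K6,K12],[K2,K7],[K3,K6,K12],[K3,K8],[K2,K6,K13],[K3,K6,K13]]⟩,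
  ⟨[s1,s21], [K11,K8,K5,K4], [[K1],[K3],[K12],[K14],[K2,K6,K13],[K2,K9,K13]]⟩,
  ⟨[s1,s31], [K11,K14,K5,K4], [[K1],[K7],[K8],[K2,K6,K12],[K3,K6,K12],[K2,K9],[K3,K10],[K2,K6,K13],[K3,K6,K13]]⟩,
  ⟨[s2,s12], [K11,K10,K1,K3], [[K5],[K13],[K8],[K2,K7,K12],[K2,K7,K14],[K6,K12],[K9,K14],[K12,K7,K4],[K7,K14,K4]]⟩,
  ⟨[s2,s32], [K11,K10,K1,K13], [[K5],[K9],[K3],[K2,K7,K12],[K2,K7,K14],[K12,K7,K4],[K2,K6],[K7,K14,K4],[K8,K4]]⟩,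
  ⟨[s3,s23], [K1,K9,K5,K14], [[K11],[K2],[K13],[K4],[K3,K6,K12],[K3,K8,K12]]⟩,
  ⟨[s3,s31], [K1,K14,K5,K4], [[K11],[K9],[K7],[K2,K6,K12],[K10,K13],[K3,K6,K12],[K8,K12],[K2,K6,K13],[K3,K6,K13]]⟩,
  ⟨[s12,s121], [K3,K11,K8,K10], [[K1],[K12],[K13],[K4],[K2,K7,K14],[K2,K9,K14]]⟩,
  ⟨[s12,s312], [K3,K10,K13,K11], [[K1],[K8],[K6],[K2,K7,K12],[K2,K7,K14],[K5,K4],[K12,K7,K4],[K7,K14,K4],[K2,K9]]⟩,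
  ⟨[s21,s121], [K3,K11,K8,K4], [[K5],[K12],[K10],[K1,K9,K14],[K2,K9,K14],[K1,K9,K13],[K7,K14],[K6,K13],[K2,K9,K13]]⟩,
  ⟨[s21,s321], [K11,K8,K4,K12], [[K5],[K3],[K7],[K10,K1],[K2,K6],[K1,K9,K14],[K2,K9,K14],[K1,K9,K13],[K2,K9,K13]]⟩,
  ⟨[s23,s123], [K2,K1,K9,K14], [[K7],[K5],[K13],[K11,K10],[K6,K12],[K3,K11,K8],[K8,K12,K4],[K3,K8,K12],[K11,K8,K4]]⟩,
  ⟨[s23,s232], [K1,K9,K13,K14], [[K10],[K5],[K2],[K3,K11,K8],[K8,K12,K4],[K3,K8,K12],[K7,K4],[K3,K6],[K11,K8,K4]]⟩,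
  ⟨[s31,s231], [K7,K14,K5,K4], [[K2],[K11],[K1],[K12],[K3,K10,K13],[K3,K6,K13]]⟩,
  ⟨[s32,s232], [K10,K1,K9,K13], [[K11],[K14],[K3],[K2],[K8,K12,K4],[K12,K7,K4]]⟩,
  ⟨[s32,s312], [K3,K10,K1,K13], [[K11],[K9],[K6],[K2,K7,K12],[K2,K7,K14],[K14,K5],[K12,K7,K4],[K8,K12],[K7,K14,K4]]⟩,
  ⟨[s121,s3121], [K3,K11,K8,K12], [[K6],[K4],[K10],[K1,K5],[K2,K7],[K1,K9,K14],[K2,K9,K14],[K1,K9,K13],[K2,K9,K13]]⟩,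
  ⟨[s123,s1231], [K2,K9,K7,K14], [[K12],[K1],[K4],[K13],[K3,K11,K8],[K3,K10,K11]]⟩,
  ⟨[s123,s1232], [K2,K9,K14,K13], [[K7],[K1],[K6],[K3,K11,K8],[K8,K12,K4],[K3,K8,K12],[K5,K4],[K3,K10],[K11,K8,K4]]⟩,
  ⟨[s231,s1231], [K2,K7,K14,K4], [[K12],[K9],[K5],[K11,K10,K1],[K10,K1,K13],[K3,K10,K11],[K6,K13],[K3,K10,K13],[K11,K8]]⟩,
  ⟨[s231,s2321], [K4,K7,K14,K12], [[K2],[K8],[K5],[K11,K10,K1],[K10,K1,K13],[K3,K6],[K1,K9],[K3,K10,K11],[K3,K10,K13]]⟩,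
  ⟨[s232,s1232], [K2,K1,K9,K13], [[K10],[K14],[K6],[K11,K5],[K7,K12],[K3,K11,K8],[K8,K12,K4],[K3,K8,K12],[K11,K8,K4]]⟩,
  ⟨[s312,s2312], [K3,K10,K6,K13], [[K1],[K12],[K11],[K2],[K14,K5,K4],[K7,K14,K4]]⟩,
  ⟨[s321,s2321], [K7,K8,K4,K12], [[K2],[K3],[K14],[K11],[K10,K1,K13],[K1,K9,K13]]⟩,
  ⟨[s321,s3121], [K3,K8,K4,K12], [[K6],[K11],[K7],[K1,K9,K14],[K2,K9,K14],[K1,K9,K13],[K14,K5],[K10,K13],[K2,K9,K13]]⟩,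
  ⟨[s1231,s12321], [K2,K7,K14,K12], [[K6],[K9],[K4],[K11,K10,K1],[K10,K1,K13],[K1,K5],[K3,K10,K11],[K3,K8],[K3,K10,K13]]⟩,
  ⟨[s1232,s12312], [K2,K9,K6,K13], [[K12],[K14],[K1],[K3],[K11,K5,K4],[K11,K8,K4]]⟩,
  ⟨[s2312,s12312], [K3,K2,K6,K13], [[K12],[K10],[K9],[K11,K1,K5],[K7,K14],[K11,K5,K4],[K11,K8],[K1,K14,K5],[K14,K5,K4]]⟩,
  ⟨[s2312,s23121], [K3,K6,K13,K12], [[K2],[K8],[K10],[K11,K1,K5],[K11,K5,K4],[K1,K14,K5],[K1,K9],[K7,K4],[K14,K5,K4]]⟩,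
  ⟨[s2321,s12321], [K2,K4,K7,K12], [[K6],[K14],[K8],[K11,K10,K1],[K11,K5],[K10,K1,K13],[K3,K10,K11],[K3,K10,K13],[K9,K13]]⟩,
  ⟨[s3121,s23121], [K3,K8,K6,K12], [[K2],[K11],[K4],[K13],[K1,K9,K14],[K1,K14,K5]]⟩,
  ⟨[s12312,s123121], [K2,K6,K13,K12], [[K7],[K3],[K9],[K11,K1,K5],[K11,K5,K4],[K10,K1],[K8,K4],[K1,K14,K5],[K14,K5,K4]]⟩,
  ⟨[s12321,s123121], [K2,K7,K6,K12], [[K14],[K3],[K4],[K13],[K11,K1,K5],[K11,K10,K1]]⟩,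
  ⟨[s23121,s123121], [K3,K2,K6,K12], [[K7],[K8],[K13],[K11,K1,K5],[K11,K5,K4],[K1,K14,K5],[K9,K14],[K10,K11],[K14,K5,K4]]⟩,
  ⟨[e,s1,s2], [K11,K10,K1,K5,K4], [[K13],[K14],[K3],[K8],[K2,K6,K12],[K12,K7]]⟩,
  ⟨[e,s1,s21], [K11,K1,K8,K5,K4], [[K10],[K3],[K12],[K14],[K9,K13],[K2,K6,K13]]⟩,
  ⟨[e,s2,s3], [K11,K10,K1,K14,K5], [[K4],[K13],[K9],[K3],[K2,K6,K12],[K2,K7]]⟩,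
  ⟨[e,s2,s12], [K11,K10,K1,K3,K5], [[K4],[K13],[K8],[K14],[K2,K7,K12],[K6,K12]]⟩,
  ⟨[e,s2,s32], [K11,K10,K1,K13,K5], [[K4],[K14],[K9],[K3],[K2,K7,K12],[K2,K6]]⟩,
  ⟨[e,s3,s23], [K11,K1,K9,K5,K14], [[K10],[K4],[K2],[K13],[K3,K6,K12],[K3,K8]]⟩,
  ⟨[s1,s21,s31], [K11,K8,K14,K5,K4], [[K1],[K3],[K12],[K7],[K2,K9],[K2,K6,K13]]⟩,
  ⟨[s1,s21,s121], [K11,K3,K8,K5,K4], [[K1],[K12],[K10],[K14],[K6,K13],[K2,K9,K13]]⟩,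
  ⟨[s1,s21,s321], [K11,K8,K12,K5,K4], [[K1],[K3],[K7],[K14],[K2,K6],[K2,K9,K13]]⟩,
  ⟨[s1,s31,s231], [K11,K7,K14,K5,K4], [[K1],[K2],[K12],[K8],[K3,K10],[K3,K6,K13]]⟩,
  ⟨[s2,s12,s121], [K11,K10,K1,K8,K3], [[K5],[K13],[K12],[K4],[K2,K7,K14],[K9,K14]]⟩,
  ⟨[s2,s32,s232], [K11,K10,K1,K9,K13], [[K5],[K14],[K3],[K2],[K12,K7,K4],[K8,K4]]⟩,
  ⟨[s3,s23,s31], [K1,K4,K9,K5,K14], [[K11],[K2],[K13],[K7],[K3,K6,K12],[K8,K12]]⟩,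
  ⟨[s3,s23,s123], [K2,K1,K9,K5,K14], [[K11],[K7],[K13],[K4],[K6,K12],[K3,K8,K12]]⟩,
  ⟨[s3,s23,s232], [K1,K13,K9,K5,K14], [[K11],[K10],[K2],[K4],[K3,K8,K12],[K3,K6]]⟩,
  ⟨[s3,s31,s231], [K1,K7,K14,K5,K4], [[K11],[K2],[K9],[K12],[K10,K13],[K3,K6,K13]]⟩,
  ⟨[s12,s21,s121], [K3,K11,K8,K4,K10], [[K1],[K5],[K12],[K13],[K2,K9,K14],[K7,K14]]⟩,
  ⟨[s12,s121,s312], [K3,K11,K8,K13,K10], [[K1],[K12],[K6],[K4],[K2,K7,K14],[K2,K9]]⟩,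
  ⟨[s12,s121,s3121], [K3,K11,K8,K12,K10], [[K1],[K6],[K4],[K13],[K2,K7],[K2,K9,K14]]⟩,
  ⟨[s12,s312,s2312], [K3,K10,K13,K11,K6], [[K1],[K12],[K8],[K2],[K5,K4],[K7,K14,K4]]⟩,
  ⟨[s21,s321,s2321], [K11,K7,K8,K4,K12], [[K2],[K5],[K3],[K14],[K10,K1],[K1,K9,K13]]⟩,
  ⟨[s23,s32,s232], [K10,K1,K9,K13,K14], [[K11],[K5],[K2],[K3],[K8,K12,K4],[K7,K4]]⟩,
  ⟨[s23,s123,s1231], [K9,K2,K1,K7,K14], [[K12],[K5],[K13],[K4],[K11,K10],[K3,K11,K8]]⟩,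
  ⟨[s31,s231,s1231], [K2,K7,K14,K5,K4], [[K12],[K11],[K1],[K9],[K6,K13],[K3,K10,K13]]⟩,
  ⟨[s31,s231,s2321], [K4,K7,K14,K5,K12], [[K2],[K11],[K8],[K1],[K3,K6],[K3,K10,K13]]⟩,
  ⟨[s32,s232,s312], [K3,K10,K1,K9,K13], [[K11],[K14],[K6],[K2],[K12,K7,K4],[K8,K12]]⟩,
  ⟨[s32,s232,s1232], [K10,K1,K9,K13,K2], [[K11],[K14],[K6],[K3],[K7,K12],[K8,K12,K4]]⟩,
  ⟨[s32,s312,s2312], [K3,K10,K1,K6,K13], [[K11],[K12],[K9],[K2],[K14,K5],[K7,K14,K4]]⟩,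
  ⟨[s121,s3121,s23121], [K3,K11,K8,K6,K12], [[K2],[K4],[K10],[K13],[K1,K5],[K1,K9,K14]]⟩,
  ⟨[s123,s231,s1231], [K2,K9,K7,K14,K4], [[K12],[K1],[K5],[K13],[K3,K10,K11],[K11,K8]]⟩,
  ⟨[s123,s1231,s1232], [K2,K9,K7,K14,K13], [[K12],[K1],[K6],[K4],[K3,K11,K8],[K3,K10]]⟩,
  ⟨[s123,s1231,s12321], [K2,K9,K7,K14,K12], [[K6],[K1],[K4],[K13],[K3,K10,K11],[K3,K8]]⟩,
  ⟨[s123,s1232,s12312], [K2,K9,K14,K13,K6], [[K12],[K7],[K1],[K3],[K5,K4],[K11,K8,K4]]⟩,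
  ⟨[s231,s321,s2321], [K7,K8,K4,K14,K12], [[K2],[K3],[K5],[K11],[K10,K1,K13],[K1,K9]]⟩,
  ⟨[s232,s1232,s12312], [K2,K1,K9,K13,K6], [[K12],[K10],[K14],[K3],[K11,K5],[K11,K8,K4]]⟩,
  ⟨[s312,s2312,s12312], [K3,K2,K6,K13,K10], [[K12],[K1],[K11],[K9],[K7,K14],[K14,K5,K4]]⟩,
  ⟨[s312,s2312,s23121], [K3,K10,K6,K13,K12], [[K2],[K1],[K11],[K8],[K7,K4],[K14,K5,K4]]⟩,
  ⟨[s321,s2321,s3121], [K3,K7,K8,K4,K12], [[K2],[K6],[K11],[K14],[K1,K9,K13],[K10,K13]]⟩,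
  ⟨[s321,s2321,s12321], [K4,K2,K8,K7,K12], [[K6],[K14],[K3],[K11],[K10,K1,K13],[K9,K13]]⟩,
  ⟨[s321,s3121,s23121], [K3,K8,K4,K6,K12], [[K2],[K11],[K7],[K13],[K1,K9,K14],[K14,K5]]⟩,
  ⟨[s1231,s12321,s123121], [K14,K2,K7,K6,K12], [[K3],[K9],[K4],[K13],[K11,K10,K1],[K1,K5]]⟩,
  ⟨[s1232,s2312,s12312], [K3,K2,K9,K6,K13], [[K12],[K14],[K1],[K10],[K11,K5,K4],[K11,K8]]⟩,
  ⟨[s1232,s12312,s123121], [K2,K9,K6,K13,K12], [[K7],[K3],[K14],[K1],[K11,K5,K4],[K8,K4]]⟩,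
  ⟨[s2312,s3121,s23121], [K3,K8,K6,K13,K12], [[K2],[K11],[K4],[K10],[K1,K14,K5],[K1,K9]]⟩,
  ⟨[s2321,s12321,s123121], [K2,K4,K7,K6,K12], [[K14],[K3],[K8],[K13],[K11,K10,K1],[K11,K5]]⟩,
  ⟨[s3121,s23121,s123121], [K3,K2,K8,K6,K12], [[K7],[K11],[K4],[K13],[K1,K14,K5],[K9,K14]]⟩,
  ⟨[s12312,s12321,s123121], [K2,K7,K6,K13,K12], [[K14],[K3],[K4],[K9],[K11,K1,K5],[K10,K1]]⟩,
  ⟨[s12321,s23121,s123121], [K3,K2,K7,K6,K12], [[K14],[K4],[K8],[K13],[K11,K1,K5],[K10,K11]]⟩,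
  ⟨[e,s1,s2,s21], [K1,K8,K4,K11,K10,K5], [[K13],[K3],[K12],[K14]]⟩,
  ⟨[e,s1,s3,s31], [K11,K1,K14,K5,K4], [[K10],[K9],[K7],[K8],[K2,K6,K12],[K3,K6,K12],[K2,K6,K13],[K3,K6,K13]]⟩,
  ⟨[e,s2,s3,s23], [K1,K11,K14,K10,K9,K5], [[K4],[K13],[K2],[K3]]⟩,
  ⟨[e,s2,s12,s121], [K1,K8,K11,K3,K10,K5], [[K4],[K13],[K14],[K12]]⟩,
  ⟨[e,s2,s32,s232], [K1,K11,K10,K13,K9,K5], [[K4],[K14],[K3],[K2]]⟩,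
  ⟨[s1,s12,s21,s121], [K8,K4,K11,K3,K10,K5], [[K1],[K12],[K14],[K13]]⟩,
  ⟨[s1,s21,s31,s231], [K8,K4,K11,K7,K14,K5], [[K1],[K2],[K3],[K12]]⟩,
  ⟨[s1,s21,s321,s2321], [K8,K4,K11,K7,K5,K12], [[K1],[K2],[K3],[K14]]⟩,
  ⟨[s2,s12,s32,s312], [K11,K10,K1,K3,K13], [[K5],[K8],[K9],[K6],[K2,K7,K12],[K2,K7,K14],[K12,K7,K4],[K7,K14,K4]]⟩,
  ⟨[s3,s23,s31,s231], [K1,K4,K7,K14,K9,K5], [[K11],[K2],[K13],[K12]]⟩,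
  ⟨[s3,s23,s32,s232], [K1,K14,K10,K13,K9,K5], [[K11],[K2],[K4],[K3]]⟩,
  ⟨[s3,s23,s123,s1231], [K1,K7,K14,K2,K9,K5], [[K11],[K12],[K13],[K4]]⟩,
  ⟨[s12,s121,s312,s2312], [K8,K11,K3,K10,K6,K13], [[K1],[K12],[K2],[K4]]⟩,
  ⟨[s12,s121,s3121,s23121], [K8,K11,K3,K10,K6,K12], [[K1],[K2],[K4],[K13]]⟩,
  ⟨[s21,s121,s321,s3121], [K3,K11,K8,K4,K12], [[K5],[K6],[K10],[K7],[K1,K9,K14],[K2,K9,K14],[K1,K9,K13],[K2,K9,K13]]⟩,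
  ⟨[s23,s123,s232,s1232], [K2,K1,K9,K13,K14], [[K7],[K10],[K5],[K6],[K3,K11,K8],[K8,K12,K4],[K3,K8,K12],[K11,K8,K4]]⟩,
  ⟨[s31,s123,s231,s1231], [K4,K7,K14,K2,K9,K5], [[K12],[K11],[K1],[K13]]⟩,
  ⟨[s31,s231,s321,s2321], [K8,K4,K7,K14,K5,K12], [[K2],[K11],[K1],[K3]]⟩,
  ⟨[s32,s232,s312,s2312], [K1,K3,K10,K6,K13,K9], [[K11],[K12],[K14],[K2]]⟩,
  ⟨[s32,s232,s1232,s12312], [K1,K10,K6,K13,K2,K9], [[K11],[K12],[K14],[K3]]⟩,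
  ⟨[s123,s1231,s1232,s12312], [K7,K14,K6,K13,K2,K9], [[K12],[K1],[K4],[K3]]⟩,
  ⟨[s123,s1231,s12321,s123121], [K7,K14,K6,K2,K9,K12], [[K3],[K1],[K4],[K13]]⟩,
  ⟨[s231,s1231,s2321,s12321], [K2,K4,K7,K14,K12], [[K6],[K8],[K9],[K5],[K11,K10,K1],[K10,K1,K13],[K3,K10,K11],[K3,K10,K13]]⟩,
  ⟨[s312,s1232,s2312,s12312], [K3,K10,K6,K13,K2,K9], [[K12],[K1],[K14],[K11]]⟩,
  ⟨[s312,s2312,s3121,s23121], [K8,K3,K10,K6,K13,K12], [[K2],[K1],[K11],[K4]]⟩,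
  ⟨[s321,s2321,s3121,s23121], [K8,K4,K7,K3,K6,K12], [[K2],[K11],[K14],[K13]]⟩,
  ⟨[s321,s2321,s12321,s123121], [K8,K4,K7,K6,K2,K12], [[K14],[K3],[K13],[K11]]⟩,
  ⟨[s1232,s12312,s12321,s123121], [K7,K6,K13,K2,K9,K12], [[K14],[K3],[K1],[K4]]⟩,
  ⟨[s2312,s12312,s23121,s123121], [K3,K2,K6,K13,K12], [[K7],[K8],[K10],[K9],[K11,K1,K5],[K11,K5,K4],[K1,K14,K5],[K14,K5,K4]]⟩,
  ⟨[s3121,s12321,s23121,s123121], [K8,K7,K3,K6,K2,K12], [[K14],[K11],[K4],[K13]]⟩,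
  ⟨[e,s1,s2,s3,s31], [K1,K4,K11,K14,K10,K5], [[K13],[K9],[K3],[K7],[K8],[K2,K6,K12]]⟩,
  ⟨[e,s1,s3,s21,s31], [K1,K8,K4,K11,K14,K5], [[K10],[K3],[K12],[K9],[K7],[K2,K6,K13]]⟩,
  ⟨[e,s1,s3,s23,s31], [K1,K4,K11,K14,K9,K5], [[K10],[K2],[K13],[K7],[K8],[K3,K6,K12]]⟩,
  ⟨[e,s1,s3,s31,s231], [K1,K4,K11,K7,K14,K5], [[K10],[K2],[K9],[K12],[K8],[K3,K6,K13]]⟩,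
  ⟨[e,s2,s12,s32,s312], [K1,K11,K3,K10,K13,K5], [[K4],[K8],[K14],[K9],[K6],[K2,K7,K12]]⟩,
  ⟨[s1,s21,s121,s321,s3121], [K8,K4,K11,K3,K5,K12], [[K1],[K6],[K10],[K7],[K14],[K2,K9,K13]]⟩,
  ⟨[s2,s12,s32,s121,s312], [K1,K8,K11,K3,K10,K13], [[K5],[K9],[K12],[K6],[K4],[K2,K7,K14]]⟩,
  ⟨[s2,s12,s32,s232,s312], [K1,K11,K3,K10,K13,K9], [[K5],[K8],[K14],[K6],[K2],[K12,K7,K4]]⟩,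
  ⟨[s2,s12,s32,s312,s2312], [K1,K11,K3,K10,K6,K13], [[K5],[K12],[K8],[K9],[K2],[K7,K14,K4]]⟩,
  ⟨[s3,s23,s123,s232,s1232], [K1,K14,K13,K2,K9,K5], [[K11],[K7],[K10],[K4],[K6],[K3,K8,K12]]⟩,
  ⟨[s12,s21,s121,s321,s3121], [K8,K4,K11,K3,K10,K12], [[K1],[K5],[K6],[K7],[K13],[K2,K9,K14]]⟩,
  ⟨[s21,s121,s321,s2321,s3121], [K8,K4,K11,K7,K3,K12], [[K2],[K5],[K6],[K10],[K14],[K1,K9,K13]]⟩,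
  ⟨[s21,s121,s321,s3121,s23121], [K8,K4,K11,K3,K6,K12], [[K2],[K5],[K10],[K7],[K13],[K1,K9,K14]]⟩,
  ⟨[s23,s32,s123,s232,s1232], [K1,K14,K10,K13,K2,K9], [[K11],[K7],[K5],[K6],[K3],[K8,K12,K4]]⟩,
  ⟨[s23,s123,s232,s1231,s1232], [K1,K7,K14,K13,K2,K9], [[K12],[K10],[K5],[K6],[K4],[K3,K11,K8]]⟩,
  ⟨[s23,s123,s232,s1232,s12312], [K1,K14,K6,K13,K2,K9], [[K12],[K7],[K10],[K5],[K3],[K11,K8,K4]]⟩,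
  ⟨[s31,s231,s1231,s2321,s12321], [K4,K7,K14,K2,K5,K12], [[K6],[K11],[K8],[K1],[K9],[K3,K10,K13]]⟩,
  ⟨[s123,s231,s1231,s2321,s12321], [K4,K7,K14,K2,K9,K12], [[K6],[K8],[K1],[K5],[K13],[K3,K10,K11]]⟩,
  ⟨[s231,s321,s1231,s2321,s12321], [K8,K4,K7,K14,K2,K12], [[K6],[K9],[K3],[K5],[K11],[K10,K1,K13]]⟩,
  ⟨[s231,s1231,s2321,s12321,s123121], [K4,K7,K14,K6,K2,K12], [[K3],[K8],[K9],[K5],[K13],[K11,K10,K1]]⟩,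
  ⟨[s312,s2312,s12312,s23121,s123121], [K3,K10,K6,K13,K2,K12], [[K7],[K1],[K11],[K8],[K9],[K14,K5,K4]]⟩,
  ⟨[s1232,s2312,s12312,s23121,s123121], [K3,K6,K13,K2,K9,K12], [[K7],[K14],[K1],[K8],[K10],[K11,K5,K4]]⟩,
  ⟨[s2312,s3121,s12312,s23121,s123121], [K8,K3,K6,K13,K2,K12], [[K7],[K11],[K4],[K10],[K9],[K1,K14,K5]]⟩,
  ⟨[s2312,s12312,s12321,s23121,s123121], [K7,K3,K6,K13,K2,K12], [[K14],[K4],[K8],[K10],[K9],[K11,K1,K5]]⟩,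
  ⟨[e,s1,s2,s3,s21,s31], [K1,K8,K4,K11,K14,K10,K5], [[K13],[K3],[K12],[K9],[K7]]⟩,
  ⟨[e,s1,s2,s3,s23,s31], [K1,K4,K11,K14,K10,K9,K5], [[K13],[K2],[K3],[K7],[K8]]⟩,
  ⟨[e,s1,s2,s12,s21,s121], [K1,K8,K4,K11,K3,K10,K5], [[K13],[K12],[K14]]⟩,
  ⟨[e,s1,s3,s21,s31,s231], [K1,K8,K4,K11,K7,K14,K5], [[K10],[K2],[K3],[K12],[K9]]⟩,
  ⟨[e,s1,s3,s23,s31,s231], [K1,K4,K11,K7,K14,K9,K5], [[K10],[K2],[K13],[K12],[K8]]⟩,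
  ⟨[e,s2,s3,s23,s32,s232], [K1,K11,K14,K10,K13,K9,K5], [[K4],[K2],[K3]]⟩,
  ⟨[e,s2,s12,s32,s121,s312], [K1,K8,K11,K3,K10,K13,K5], [[K4],[K14],[K9],[K12],[K6]]⟩,
  ⟨[e,s2,s12,s32,s232,s312], [K1,K11,K3,K10,K13,K9,K5], [[K4],[K8],[K14],[K6],[K2]]⟩,
  ⟨[s1,s12,s21,s121,s321,s3121], [K8,K4,K11,K3,K10,K5,K12], [[K1],[K6],[K7],[K14],[K13]]⟩,
  ⟨[s1,s21,s31,s231,s321,s2321], [K8,K4,K11,K7,K14,K5,K12], [[K1],[K2],[K3]]⟩,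
  ⟨[s1,s21,s121,s321,s2321,s3121], [K8,K4,K11,K7,K3,K5,K12], [[K1],[K2],[K6],[K10],[K14]]⟩,
  ⟨[s2,s12,s32,s121,s312,s2312], [K1,K8,K11,K3,K10,K6,K13], [[K5],[K12],[K9],[K2],[K4]]⟩,
  ⟨[s2,s12,s32,s232,s312,s2312], [K1,K11,K3,K10,K6,K13,K9], [[K5],[K12],[K8],[K14],[K2]]⟩,
  ⟨[s3,s23,s31,s123,s231,s1231], [K1,K4,K7,K14,K2,K9,K5], [[K11],[K12],[K13]]⟩,
  ⟨[s3,s23,s32,s123,s232,s1232], [K1,K14,K10,K13,K2,K9,K5], [[K11],[K7],[K4],[K6],[K3]]⟩,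
  ⟨[s3,s23,s123,s232,s1231,s1232], [K1,K7,K14,K13,K2,K9,K5], [[K11],[K12],[K10],[K4],[K6]]⟩,
  ⟨[s12,s21,s121,s321,s3121,s23121], [K8,K4,K11,K3,K10,K6,K12], [[K1],[K2],[K5],[K7],[K13]]⟩,
  ⟨[s12,s121,s312,s2312,s3121,s23121], [K8,K11,K3,K10,K6,K13,K12], [[K1],[K2],[K4]]⟩,
  ⟨[s21,s121,s321,s2321,s3121,s23121], [K8,K4,K11,K7,K3,K6,K12], [[K2],[K5],[K10],[K14],[K13]]⟩,
  ⟨[s23,s32,s123,s232,s1232,s12312], [K1,K14,K10,K6,K13,K2,K9], [[K11],[K12],[K7],[K5],[K3]]⟩,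
  ⟨[s23,s123,s232,s1231,s1232,s12312], [K1,K7,K14,K6,K13,K2,K9], [[K12],[K10],[K5],[K4],[K3]]⟩,
  ⟨[s31,s123,s231,s1231,s2321,s12321], [K4,K7,K14,K2,K9,K5,K12], [[K6],[K11],[K8],[K1],[K13]]⟩,
  ⟨[s31,s231,s321,s1231,s2321,s12321], [K8,K4,K7,K14,K2,K5,K12], [[K6],[K11],[K1],[K9],[K3]]⟩,
  ⟨[s32,s232,s312,s1232,s2312,s12312], [K1,K3,K10,K6,K13,K2,K9], [[K11],[K12],[K14]]⟩,
  ⟨[s123,s231,s1231,s2321,s12321,s123121], [K4,K7,K14,K6,K2,K9,K12], [[K3],[K8],[K1],[K5],[K13]]⟩,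
  ⟨[s123,s1231,s1232,s12312,s12321,s123121], [K7,K14,K6,K13,K2,K9,K12], [[K3],[K1],[K4]]⟩,
  ⟨[s231,s321,s1231,s2321,s12321,s123121], [K8,K4,K7,K14,K6,K2,K12], [[K3],[K9],[K5],[K13],[K11]]⟩,
  ⟨[s312,s1232,s2312,s12312,s23121,s123121], [K3,K10,K6,K13,K2,K9,K12], [[K7],[K1],[K14],[K11],[K8]]⟩,
  ⟨[s312,s2312,s3121,s12312,s23121,s123121], [K8,K3,K10,K6,K13,K2,K12], [[K7],[K1],[K11],[K4],[K9]]⟩,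
  ⟨[s321,s2321,s3121,s12321,s23121,s123121], [K8,K4,K7,K3,K6,K2,K12], [[K14],[K11],[K13]]⟩,
  ⟨[s1232,s2312,s12312,s12321,s23121,s123121], [K7,K3,K6,K13,K2,K9,K12], [[K14],[K1],[K4],[K8],[K10]]⟩,
  ⟨[s2312,s3121,s12312,s12321,s23121,s123121], [K8,K7,K3,K6,K13,K2,K12], [[K14],[K11],[K4],[K10],[K9]]⟩]

end SL4

end

namespace SL4

/-! Since `λ = μ + xα₁ + yα₂ + zα₃`, each `σ(λ + ρ) - ρ - μ` is an integral combination of simple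
roots, and Kostant's function is positive there exactly when its three coefficients are nonnegative
(`kostant_pos_iff`). The group `W` acts on `ℝ⁴` as the symmetric group permuting the coordinates.
The coefficient of `α_k` is the sum of the first `k` coordinates of `σ(λ + ρ)` minus the same sum
for `μ + ρ`, so it depends only on which `k` coordinates of `λ + ρ` are moved to the front. This
gives one form `L_S` for each of the 14 proper nonempty subsets `S` of the four coordinates, and the
24 elements of `W` correspond to the 24 maximal chains of such subsets.

The coordinates of `λ + ρ` sum to zero, and those of `μ + ρ` sum to zero and strictly decrease.
Hence the forms of complementary subsets are never both nonnegative, nonnegativity for two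
singletons passes to their union, and nonnegativity for two triples passes to their intersection.
These relations leave finitely many truth assignments for the `K_i`. In each of them either no row
is satisfied and no element is active, or exactly one row is satisfied and it lists the active
elements (`isClassification_assignment`). Because the rows list distinct sets (`rows_pairwise`), the
conditions of a row are equivalent to the alternation set being that of the row.

Conversely every row occurs for every `μ` (`exists_samplePoint`): the dot action of `W` on `λ`
translates the alternation set, so one point for each orbit of sets is enough, and it can be chosen
with coordinates affine in `c₁`, `c₂`, `c₃`. -/

/-! ### Boolean classification of the truth values of the `K_i` -/

/-- The 24 words. -/
def Word.all : List Word :=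
  [.e, .s1, .s2, .s3, .s12, .s21, .s23, .s31, .s32, .s121, .s123, .s231, .s232, .s312, .s321,
    .s1231, .s1232, .s2312, .s2321, .s3121, .s12312, .s12321, .s23121, .s123121]

theorem Word.mem_all (w : Word) : w ∈ Word.all := by
  cases w <;> decide

/-- Whether a truth assignment to the labels satisfies the three conditions of a word. -/
def Word.active (p : Label → Bool) (w : Word) : Bool :=
  p w.coeffs.1 && (p w.coeffs.2.1 && p w.coeffs.2.2)

/-- Whether a truth assignment to the labels satisfies the conditions of a row. -/
def Row.sat (p : Label → Bool) (r : Row) : Bool :=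
  r.pos.all p && r.neg.all fun d => d.any fun k => !p k

/-- Whether the active words of a truth assignment are exactly those listed in a row. -/
def Row.isActiveSet (p : Label → Bool) (r : Row) : Bool :=
  Word.all.all fun w => w.active p == r.words.contains w

/-- Whether a list of rows is either empty, in which case no word is active, or consists of a single
row, which lists the active words. -/
def isClassification (p : Label → Bool) : List Row → Bool
  | [] => Word.all.all fun w => !w.active p
  | [r] => r.isActiveSet p
  | _ => false

/-- The truth assignment with the given values. -/
def assignment (a₁ a₂ a₃ a₄ a₅ a₆ a₇ a₈ a₉ a₁₀ a₁₁ a₁₂ a₁₃ a₁₄ : Bool) : Label → Bool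
  | .K1 => a₁ | .K2 => a₂ | .K3 => a₃ | .K4 => a₄ | .K5 => a₅ | .K6 => a₆ | .K7 => a₇
  | .K8 => a₈ | .K9 => a₉ | .K10 => a₁₀ | .K11 => a₁₁ | .K12 => a₁₂ | .K13 => a₁₃ | .K14 => a₁₄

set_option synthInstance.maxSize 1024 in
set_option synthInstance.maxHeartbeats 400000 in
-- The guards are the relations between subsets of coordinates: the seven exclusions pair
-- complementary subsets, and each two-element subset is implied by its two singletons and by the
-- two triples containing it. Each guard stands directly after the variables it mentions, so that
-- evaluation prunes early: at most `3 ^ 7` of the `2 ^ 14` assignments reach the final test.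
theorem isClassification_assignment :
    ∀ a₁ a₁₂ : Bool, ¬ (a₁ ∧ a₁₂) → ∀ a₂ a₁₁ : Bool, ¬ (a₂ ∧ a₁₁) →
    ∀ a₃ a₁₄ : Bool, ¬ (a₃ ∧ a₁₄) → ∀ a₄ a₁₃ : Bool, ¬ (a₄ ∧ a₁₃) →
    ∀ a₅ a₆ : Bool, ¬ (a₅ ∧ a₆) → (a₁ ∧ a₄ → a₅) → (a₁₁ ∧ a₁₄ → a₅) →
      (a₂ ∧ a₃ → a₆) → (a₁₂ ∧ a₁₃ → a₆) →
    ∀ a₇ a₁₀ : Bool, ¬ (a₇ ∧ a₁₀) → (a₂ ∧ a₄ → a₇) → (a₁₂ ∧ a₁₄ → a₇) →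
      (a₁ ∧ a₃ → a₁₀) → (a₁₁ ∧ a₁₃ → a₁₀) →
    ∀ a₈ a₉ : Bool, ¬ (a₈ ∧ a₉) → (a₃ ∧ a₄ → a₈) → (a₁₁ ∧ a₁₂ → a₈) →
      (a₁ ∧ a₂ → a₉) → (a₁₃ ∧ a₁₄ → a₉) →
    let p := assignment a₁ a₂ a₃ a₄ a₅ a₆ a₇ a₈ a₉ a₁₀ a₁₁ a₁₂ a₁₃ a₁₄
    isClassification p (rows.filter (Row.sat p)) = true := by
  decide +kernel

/-- Whether the words of one row all occur in another. -/
def Row.subset (r r' : Row) : Bool :=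
  r.words.all fun w => r'.words.contains w

/-- Mutual inclusion, rather than equality of lists, is what distinguishes the underlying sets,
since the order of the words is irrelevant. Both the count of 195 and the converse half of each
row's criterion rest on this. -/
theorem rows_pairwise : rows.Pairwise fun r r' => (r.subset r' && r'.subset r) = false := by
  decide +kernel

/-! ### Realizing every row uniformly in `μ` -/

/-- An affine form `const + m₁c₁ + m₂c₂ + m₃c₃` with integral coefficients. -/
structure Affine where
  const : ℤ
  m₁ : ℤ
  m₂ : ℤ
  m₃ : ℤ

/-- The value of an affine form. -/
def Affine.eval (c₁ c₂ c₃ : ℕ) (a : Affine) : ℤ := a.const + a.m₁ * c₁ + a.m₂ * c₂ + a.m₃ * c₃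

/-- A criterion for an affine form to be nonnegative on `ℕ³`. -/
def Affine.nonneg (a : Affine) : Bool :=
  decide (0 ≤ a.const) && (decide (0 ≤ a.m₁) && (decide (0 ≤ a.m₂) && decide (0 ≤ a.m₃)))

/-- A criterion for an affine form to be negative on `ℕ³`. -/
def Affine.neg (a : Affine) : Bool :=
  decide (a.const < 0) && (decide (a.m₁ ≤ 0) && (decide (a.m₂ ≤ 0) && decide (a.m₃ ≤ 0)))

theorem Affine.eval_nonneg {a : Affine} (h : a.nonneg = true) (c₁ c₂ c₃ : ℕ) :
    0 ≤ a.eval c₁ c₂ c₃ := by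
  simp only [Affine.nonneg, Bool.and_eq_true, decide_eq_true_eq] at h
  obtain ⟨h₀, h₁, h₂, h₃⟩ := h
  unfold Affine.eval
  positivity

theorem Affine.eval_neg {a : Affine} (h : a.neg = true) (c₁ c₂ c₃ : ℕ) :
    a.eval c₁ c₂ c₃ < 0 := by
  simp only [Affine.neg, Bool.and_eq_true, decide_eq_true_eq] at h
  obtain ⟨h₀, h₁, h₂, h₃⟩ := h
  have k₁ := mul_nonpos_of_nonpos_of_nonneg h₁ (Int.natCast_nonneg c₁)
  have k₂ := mul_nonpos_of_nonpos_of_nonneg h₂ (Int.natCast_nonneg c₂)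
  have k₃ := mul_nonpos_of_nonpos_of_nonneg h₃ (Int.natCast_nonneg c₃)
  unfold Affine.eval
  linarith

/-- A point `(x, y, z)` whose coordinates are affine forms in `c₁`, `c₂`, `c₃`. -/
structure AffinePoint where
  x : Affine
  y : Affine
  z : Affine

/-- The values of the labelled forms at an affine point, as affine forms in `c₁`, `c₂`, `c₃`. -/
def Label.affine (u : AffinePoint) (k : Label) : Affine where
  const := k.form 0 0 0 u.x.const u.y.const u.z.const
  -- A form is affine in all six arguments jointly, so its value at the `c₁`-direction of the point,
  -- minus its constant term, is the coefficient of `c₁`. The constant term itself is already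
  -- counted in `const`.
  m₁ := k.form 1 0 0 u.x.m₁ u.y.m₁ u.z.m₁ - k.form 0 0 0 0 0 0
  m₂ := k.form 0 1 0 u.x.m₂ u.y.m₂ u.z.m₂ - k.form 0 0 0 0 0 0
  m₃ := k.form 0 0 1 u.x.m₃ u.y.m₃ u.z.m₃ - k.form 0 0 0 0 0 0

theorem Label.eval_affine (c₁ c₂ c₃ : ℕ) (u : AffinePoint) (k : Label) :
    (k.affine u).eval c₁ c₂ c₃ =
      k.form c₁ c₂ c₃ (u.x.eval c₁ c₂ c₃) (u.y.eval c₁ c₂ c₃) (u.z.eval c₁ c₂ c₃) := by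
  cases k <;> simp only [Label.affine, Label.form, Affine.eval] <;> push_cast <;> ring

/-- The image of an affine point under the dot action of the element given by a word. -/
def Word.dot (w : Word) (u : AffinePoint) : AffinePoint :=
  ⟨w.coeffs.1.affine u, w.coeffs.2.1.affine u, w.coeffs.2.2.affine u⟩

/-- A criterion for the conditions of a row to hold at an affine point for all `c₁`, `c₂`, `c₃`. -/
def Row.satAt (u : AffinePoint) (r : Row) : Bool :=
  (r.pos.all fun k => (k.affine u).nonneg) &&
    r.neg.all fun d => d.any fun k => (k.affine u).neg

theorem Row.cond_of_satAt {u : AffinePoint} {r : Row} (h : r.satAt u = true) (c₁ c₂ c₃ : ℕ) :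
    r.Cond c₁ c₂ c₃ (u.x.eval c₁ c₂ c₃) (u.y.eval c₁ c₂ c₃) (u.z.eval c₁ c₂ c₃) := by
  simp only [Row.satAt, Bool.and_eq_true, List.all_eq_true, List.any_eq_true] at h
  refine ⟨fun k hk => ?_, fun d hd => ?_⟩
  · rw [Label.Holds, ← Label.eval_affine]
    exact Affine.eval_nonneg (h.1 k hk) _ _ _
  · obtain ⟨k, hk, hn⟩ := h.2 d hd
    refine ⟨k, hk, ?_⟩
    rw [Label.Holds, ← Label.eval_affine, not_le]
    exact Affine.eval_neg hn _ _ _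

/-- Affine points that represent the nonempty alternation sets up to the dot action. -/
def samplePoints : List AffinePoint := [
  ⟨⟨0, 0, 0, 0⟩, ⟨0, 0, 0, 0⟩, ⟨0, 0, 0, 0⟩⟩,
  ⟨⟨0, 0, 0, 0⟩, ⟨1, 1, 0, 0⟩, ⟨1, 1, 0, 0⟩⟩,
  ⟨⟨0, 0, 0, 0⟩, ⟨0, 0, 0, 0⟩, ⟨1, 0, 1, 0⟩⟩,
  ⟨⟨1, 0, 0, 1⟩, ⟨1, 0, 0, 1⟩, ⟨0, 0, 0, 0⟩⟩,
  ⟨⟨1, 0, 0, 0⟩, ⟨2, 1, 0, 0⟩, ⟨2, 1, 1, 0⟩⟩,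
  ⟨⟨2, 0, 1, 1⟩, ⟨2, 0, 0, 1⟩, ⟨1, 0, 0, 0⟩⟩,
  ⟨⟨0, 0, 0, 0⟩, ⟨1, 1, 0, 0⟩, ⟨2, 1, 1, 0⟩⟩,
  ⟨⟨0, 0, 0, 0⟩, ⟨1, 1, 0, 1⟩, ⟨0, 0, 0, 0⟩⟩,
  ⟨⟨2, 0, 1, 1⟩, ⟨1, 0, 0, 1⟩, ⟨0, 0, 0, 0⟩⟩,
  ⟨⟨2, 0, 1, 1⟩, ⟨3, 1, 1, 1⟩, ⟨2, 1, 1, 0⟩⟩,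
  ⟨⟨0, 0, 0, 0⟩, ⟨1, 1, 0, 0⟩, ⟨3, 2, 1, 0⟩⟩,
  ⟨⟨2, 0, 1, 1⟩, ⟨5, 1, 2, 2⟩, ⟨4, 1, 2, 1⟩⟩,
  ⟨⟨4, 1, 2, 1⟩, ⟨5, 2, 2, 1⟩, ⟨2, 1, 1, 0⟩⟩,
  ⟨⟨3, 0, 1, 2⟩, ⟨1, 0, 0, 1⟩, ⟨0, 0, 0, 0⟩⟩]

/-- If `u` is the point of `λ`, then `w.dot u` is the point of `w(λ + ρ) - ρ`, whose alternation set
is that of `λ` multiplied on the right by `w⁻¹`. Hence 14 points, moved by the 24 words, serve all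
194 rows. The sign criteria look only at coefficients, which makes one finite check valid for all
`c₁`, `c₂`, `c₃`. -/
theorem exists_samplePoint :
    ∀ r ∈ rows, ∃ u ∈ samplePoints, ∃ w ∈ Word.all, r.satAt (w.dot u) = true := by
  decide +kernel

theorem exists_cond {r : Row} (hr : r ∈ rows) (c₁ c₂ c₃ : ℕ) :
    ∃ x y z : ℤ, r.Cond c₁ c₂ c₃ x y z := by
  obtain ⟨u, -, w, -, h⟩ := exists_samplePoint r hr
  exact ⟨_, _, _, Row.cond_of_satAt h c₁ c₂ c₃⟩

/-! ### Roots and weights in coordinates -/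

theorem α_zero : α 0 = !₂[1, -1, 0, 0] := by
  ext j; fin_cases j <;> simp [α]

theorem α_one : α 1 = !₂[0, 1, -1, 0] := by
  ext j; fin_cases j <;> simp [α]

theorem α_two : α 2 = !₂[0, 0, 1, -1] := by
  ext j; fin_cases j <;> simp [α]

theorem sum_posRoots (f : V → V) :
    ∑ β ∈ posRoots, f β =
      f (α 0) + f (α 1) + f (α 2) + f (α 0 + α 1) + f (α 1 + α 2) + f (α 0 + α 1 + α 2) := by
  -- The sum over the finset has six terms only if the six roots are distinct; each pair is
  -- separated by a coordinate in which it differs.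
  have ne {u v : V} (j : Fin 4) (h : u j ≠ v j) : u ≠ v := fun e => h (by rw [e])
  unfold posRoots
  rw [Finset.sum_insert, Finset.sum_insert, Finset.sum_insert, Finset.sum_insert,
    Finset.sum_insert, Finset.sum_singleton]
  · abel
  all_goals simp only [Finset.mem_insert, Finset.mem_singleton, not_or, α_zero, α_one, α_two]
  · exact ne 0 (by simp)
  · exact ⟨ne 0 (by simp), ne 2 (by simp)⟩
  · exact ⟨ne 0 (by simp), ne 1 (by simp), ne 0 (by simp)⟩
  · exact ⟨ne 1 (by simp), ne 0 (by simp), ne 3 (by simp), ne 0 (by simp)⟩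
  · exact ⟨ne 0 (by simp), ne 0 (by simp), ne 1 (by simp), ne 0 (by simp), ne 1 (by simp)⟩

theorem ρ_eq : ρ = !₂[3 / 2, 1 / 2, -1 / 2, -3 / 2] := by
  unfold ρ
  rw [sum_posRoots (fun β => β), α_zero, α_one, α_two]
  ext j; fin_cases j <;> simp <;> norm_num

theorem weight_eq (m n k : ℤ) : weight m n k =
    !₂[(3 * m + 2 * n + k : ℝ) / 4, (-m + 2 * n + k : ℝ) / 4, (-m - 2 * n + k : ℝ) / 4,
      (-m - 2 * n - 3 * k : ℝ) / 4] := by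
  simp only [weight, ϖ, α_zero, α_one, α_two]
  ext j; fin_cases j <;> simp <;> ring

/-! ### Positivity of Kostant's partition function -/

/-- The pairing with the fundamental coweight that is dual to `α i`. -/
def coweight (i : Fin 3) : V →ₗ[ℝ] ℝ where
  toFun v := ∑ j ∈ Finset.univ.filter fun j : Fin 4 => j ≤ i.castSucc, v j
  map_add' u v := by simp [Finset.sum_add_distrib]
  map_smul' c v := by simp [Finset.mul_sum]

theorem coweight_α (i j : Fin 3) : coweight i (α j) = if i = j then 1 else 0 := by
  fin_cases j <;> fin_cases i <;>
    simp [coweight, α_zero, α_one, α_two, Finset.sum_filter, Fin.sum_univ_four, Fin.le_def]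

theorem coweight_nonneg (i : Fin 3) {β : V} (hβ : β ∈ posRoots) : 0 ≤ coweight i β := by
  simp only [posRoots, Finset.mem_insert, Finset.mem_singleton] at hβ
  rcases hβ with rfl | rfl | rfl | rfl | rfl | rfl <;> simp only [map_add, coweight_α] <;>
    fin_cases i <;> simp

/-- The fundamental coweights read off the coefficients `a i` and are nonnegative on positive roots,
so any decomposition forces `0 ≤ a i`. Conversely, the simple roots alone already give a
decomposition. -/
theorem kostant_pos_iff (a : Fin 3 → ℤ) :
    0 < kostant (∑ i, (a i : ℝ) • α i) ↔ ∀ i, 0 ≤ a i := by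
  rw [kostant, Set.encard_pos]
  constructor
  · rintro ⟨f, hf⟩ i
    have h := congrArg (coweight i) hf
    simp only [map_sum, map_smul, coweight_α, smul_eq_mul, mul_ite, mul_one, mul_zero,
      Finset.sum_ite_eq, Finset.mem_univ, if_true, map_nsmul] at h
    have : (0 : ℝ) ≤ a i := h ▸
      Finset.sum_nonneg fun β _ => nsmul_nonneg (coweight_nonneg i β.2) _
    exact_mod_cast this
  · intro h
    have mem (i : Fin 3) : α i ∈ posRoots := by fin_cases i <;> simp [posRoots]
    classical
    -- Multiplicity `a i` at `α i` and zero at the other positive roots. Written as a sum over `i`,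
    -- it needs no case distinction on `β`, and exchanging the two sums isolates each `α i`.
    refine ⟨fun β => ∑ i, if β = ⟨α i, mem i⟩ then (a i).toNat else 0, ?_⟩
    simp only [Set.mem_ofPred_eq, Finset.sum_smul, ite_smul, zero_smul]
    rw [Finset.sum_comm]
    refine Finset.sum_congr rfl fun i _ => ?_
    rw [Finset.sum_ite_eq' Finset.univ, if_pos (Finset.mem_univ _), ← Nat.cast_smul_eq_nsmul ℝ]
    congr 1
    exact_mod_cast Int.toNat_of_nonneg (h i)

/-! ### The Weyl group as the symmetric group on four coordinates -/

/-- As `‖α i‖² = 2`, the reflection subtracts from `v` the multiple of `α i` by the difference of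
two adjacent coordinates, which exchanges them. -/
theorem s_apply (i : Fin 3) (v : V) (j : Fin 4) :
    (s i : V ≃ₗᵢ[ℝ] V) v j = v (Equiv.swap i.castSucc i.succ j) := by
  have h : (s i : V ≃ₗᵢ[ℝ] V) v = v - (v i.castSucc - v i.succ) • α i := by
    have hn : ‖α i‖ ^ 2 = 2 := by
      rw [EuclideanSpace.real_norm_sq_eq]
      fin_cases i <;> simp [α, Fin.sum_univ_four] <;> norm_num
    have hi : inner ℝ (α i) v = v i.castSucc - v i.succ := by
      simp [α, inner_sub_left, EuclideanSpace.inner_single_left]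
    simp only [s]
    rw [Submodule.reflection_orthogonal_apply, Submodule.reflection_singleton_apply, hi]
    simp only [RCLike.ofReal_real_eq_id, id_eq, hn, two_smul, ← add_smul, neg_sub]
    congr 2
    ring
  rw [h]
  fin_cases i <;> fin_cases j <;>
    simp [α, Equiv.swap_apply_def]

/-- The letters of a word. -/
def Word.letters : Word → List (Fin 3)
  | .e => []
  | .s1 => [0]
  | .s2 => [1]
  | .s3 => [2]
  | .s12 => [0, 1]
  | .s21 => [1, 0]
  | .s23 => [1, 2]
  | .s31 => [2, 0]
  | .s32 => [2, 1]
  | .s121 => [0, 1, 0]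
  | .s123 => [0, 1, 2]
  | .s231 => [1, 2, 0]
  | .s232 => [1, 2, 1]
  | .s312 => [2, 0, 1]
  | .s321 => [2, 1, 0]
  | .s1231 => [0, 1, 2, 0]
  | .s1232 => [0, 1, 2, 1]
  | .s2312 => [1, 2, 0, 1]
  | .s2321 => [1, 2, 1, 0]
  | .s3121 => [2, 0, 1, 0]
  | .s12312 => [0, 1, 2, 0, 1]
  | .s12321 => [0, 1, 2, 1, 0]
  | .s23121 => [1, 2, 0, 1, 0]
  | .s123121 => [0, 1, 2, 0, 1, 0]

theorem Word.elt_eq_prod (w : Word) : w.elt = (w.letters.map s).prod := by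
  cases w <;> simp [Word.elt, Word.letters, mul_assoc]

/-- The permutation of the coordinates by which a product of simple reflections acts. -/
def coordPerm : List (Fin 3) → Equiv.Perm (Fin 4)
  | [] => 1
  -- Permutations act by precomposition on coordinates, which reverses products: the leading letter,
  -- applied last to the vector, acts first on the index.
  | i :: l => coordPerm l * Equiv.swap i.castSucc i.succ

theorem prod_apply (l : List (Fin 3)) (v : V) (j : Fin 4) :
    ((l.map s).prod : V ≃ₗᵢ[ℝ] V) v j = v (coordPerm l j) := by
  induction l generalizing j with
  | nil => simp [coordPerm]
  | cons i l ih =>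
    rw [List.map_cons, List.prod_cons, Subgroup.coe_mul, LinearIsometryEquiv.coe_mul,
      Function.comp_apply, s_apply, ih]
    rfl

theorem Word.elt_apply (w : Word) (v : V) (j : Fin 4) :
    (w.elt : V ≃ₗᵢ[ℝ] V) v j = v (coordPerm w.letters j) := by
  rw [Word.elt_eq_prod, prod_apply]

theorem coordPerm_injective (w w' : Word) (h : coordPerm w.letters = coordPerm w'.letters) :
    w = w' := by
  have key : ∀ w ∈ Word.all, ∀ w' ∈ Word.all,
    (∀ j, coordPerm w.letters j = coordPerm w'.letters j) → w = w' := by decide +kernel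
  exact key w w.mem_all w' w'.mem_all fun j => by rw [h]

theorem exists_coordPerm (π : Equiv.Perm (Fin 4)) : ∃ w : Word, coordPerm w.letters = π := by
  have key : ∀ π : Equiv.Perm (Fin 4), ∃ w ∈ Word.all, ∀ j, coordPerm w.letters j = π j := by
    decide +kernel
  obtain ⟨w, -, h⟩ := key π
  exact ⟨w, Equiv.ext h⟩

theorem exists_perm_of_mem_weylGroup {g : V ≃ₗᵢ[ℝ] V} (hg : g ∈ weylGroup) :
    ∃ π : Equiv.Perm (Fin 4), ∀ (v : V) (j : Fin 4), g v j = v (π j) := by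
  induction hg using Subgroup.closure_induction with
  | mem g hg =>
    obtain ⟨i, rfl⟩ := hg
    exact ⟨_, s_apply i⟩
  | one => exact ⟨1, fun _ _ => rfl⟩
  | mul g h _ _ ihg ihh =>
    obtain ⟨π, hπ⟩ := ihg
    obtain ⟨τ, hτ⟩ := ihh
    exact ⟨τ * π, fun v j => by
      rw [LinearIsometryEquiv.coe_mul, Function.comp_apply, hπ, hτ]; rfl⟩
  | inv g _ ih =>
    obtain ⟨π, hπ⟩ := ih
    refine ⟨π⁻¹, fun v j => ?_⟩
    have h := hπ (g⁻¹ v) (π⁻¹ j)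
    rw [show π (π⁻¹ j) = j from π.apply_symm_apply j,
      show g (g⁻¹ v) = v from g.apply_symm_apply v] at h
    exact h.symm

/-- Every element of the group is determined by a permutation of the coordinates, and the 24 words
realize each of the 24 permutations once. -/
theorem Word.elt_bijective : Function.Bijective Word.elt := by
  constructor
  · intro w w' h
    apply coordPerm_injective
    ext j
    -- The test vector `(0, 1, 2, 3)` has distinct coordinates, so its image determines the
    -- permutation.
    have h' := Word.elt_apply w (WithLp.toLp 2 fun j => ((j : ℕ) : ℝ)) j
    rw [h, Word.elt_apply] at h'
    exact Nat.cast_injective (R := ℝ) h'.symm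
  · rintro ⟨g, hg⟩
    obtain ⟨π, hπ⟩ := exists_perm_of_mem_weylGroup hg
    obtain ⟨w, hw⟩ := exists_coordPerm π
    refine ⟨w, Subtype.ext (LinearIsometryEquiv.ext fun v => ?_)⟩
    ext j
    rw [Word.elt_apply, hw, hπ]

/-! ### From alternation sets to the fourteen sign conditions -/

/-- The weight `λ` with parameters `x`, `y`, `z`. -/
noncomputable def lam (c₁ c₂ c₃ : ℕ) (x y z : ℤ) : V :=
  weight (2 * x - y + c₁) (2 * y - x - z + c₂) (2 * z - y + c₃)

theorem Word.elt_lam_add_ρ (c₁ c₂ c₃ : ℕ) (x y z : ℤ) (w : Word) :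
    (w.elt : V ≃ₗᵢ[ℝ] V) (lam c₁ c₂ c₃ x y z + ρ) - ρ - weight c₁ c₂ c₃ =
      (w.coeffs.1.form c₁ c₂ c₃ x y z : ℝ) • α 0 +
      (w.coeffs.2.1.form c₁ c₂ c₃ x y z : ℝ) • α 1 +
      (w.coeffs.2.2.form c₁ c₂ c₃ x y z : ℝ) • α 2 := by
  -- In these coordinates each `w` merely permutes the entries, and the claim becomes a linear
  -- identity for each word and coordinate.
  have hv : lam c₁ c₂ c₃ x y z + ρ =
      !₂[(3 * c₁ + 2 * c₂ + c₃ : ℝ) / 4 + x + 3 / 2, (-c₁ + 2 * c₂ + c₃ : ℝ) / 4 - x + y + 1 / 2,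
        (-c₁ - 2 * c₂ + c₃ : ℝ) / 4 - y + z - 1 / 2, (-c₁ - 2 * c₂ - 3 * c₃ : ℝ) / 4 - z - 3 / 2] := by
    rw [lam, weight_eq, ρ_eq]
    ext j; fin_cases j <;> simp <;> ring
  rw [hv, ρ_eq, weight_eq, α_zero, α_one, α_two]
  ext j
  simp only [PiLp.sub_apply, PiLp.add_apply, PiLp.smul_apply, Word.elt_apply]
  cases w <;> fin_cases j <;>
    simp [coordPerm, Word.letters, Word.coeffs, Label.form, Equiv.swap_apply_def] <;> ring

theorem Word.elt_mem_altSet (c₁ c₂ c₃ : ℕ) (x y z : ℤ) (w : Word) :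
    w.elt ∈ altSet (lam c₁ c₂ c₃ x y z) (weight c₁ c₂ c₃) ↔
      w.coeffs.1.Holds c₁ c₂ c₃ x y z ∧ w.coeffs.2.1.Holds c₁ c₂ c₃ x y z ∧
        w.coeffs.2.2.Holds c₁ c₂ c₃ x y z := by
  have h := kostant_pos_iff ![w.coeffs.1.form c₁ c₂ c₃ x y z, w.coeffs.2.1.form c₁ c₂ c₃ x y z,
    w.coeffs.2.2.form c₁ c₂ c₃ x y z]
  simp only [Fin.sum_univ_three, Fin.forall_fin_succ, IsEmpty.forall_iff,
    and_true, Matrix.cons_val] at h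
  rw [altSet, Set.mem_ofPred_eq, add_comm (weight _ _ _), ← sub_sub, Word.elt_lam_add_ρ]
  exact h

/-- The truth values of the conditions of the labels at a point. -/
def truth (c₁ c₂ c₃ : ℕ) (x y z : ℤ) (k : Label) : Bool := decide (0 ≤ k.form c₁ c₂ c₃ x y z)

/-- Each guard of the Boolean check comes from adding two forms. For example `L₁ + L₁₂ = -c₁ - c₂ -
c₃ - 3 < 0` excludes `K₁` with `K₁₂`, and `L₅ = L₁ + L₄ + c₁ + 1` shows that `K₁` and `K₄` imply
`K₅`. -/
theorem isClassification_truth (c₁ c₂ c₃ : ℕ) (x y z : ℤ) :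
    isClassification (truth c₁ c₂ c₃ x y z) (rows.filter (Row.sat (truth c₁ c₂ c₃ x y z))) =
      true := by
  obtain ⟨p, hp⟩ : ∃ p, p = truth c₁ c₂ c₃ x y z := ⟨_, rfl⟩
  have hk (k : Label) : p k = true ↔ 0 ≤ k.form c₁ c₂ c₃ x y z := by
    rw [hp, truth, decide_eq_true_eq]
  have h : p = assignment (p .K1) (p .K2) (p .K3) (p .K4) (p .K5) (p .K6) (p .K7) (p .K8) (p .K9)
      (p .K10) (p .K11) (p .K12) (p .K13) (p .K14) := by
    funext k
    cases k <;> rfl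
  rw [← hp, h]
  refine isClassification_assignment _ _ ?_ _ _ ?_ _ _ ?_ _ _ ?_ _ _ ?_ ?_ ?_ ?_ ?_ _ _ ?_ ?_ ?_ ?_
    ?_ _ _ ?_ ?_ ?_ ?_ ?_ <;> simp only [hk, Label.form] <;> omega

/-! ### The classification by rows -/

section

variable {c₁ c₂ c₃ : ℕ} {x y z : ℤ}

theorem Row.sat_truth {r : Row} :
    r.sat (truth c₁ c₂ c₃ x y z) = true ↔ r.Cond c₁ c₂ c₃ x y z := by
  simp [Row.sat, Row.Cond, truth, Label.Holds]

theorem Word.active_truth {w : Word} :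
    w.active (truth c₁ c₂ c₃ x y z) = true ↔
      w.elt ∈ altSet (lam c₁ c₂ c₃ x y z) (weight c₁ c₂ c₃) := by
  simp [Word.elt_mem_altSet, Word.active, truth, Label.Holds]

theorem Row.elt_mem_carrier {r : Row} {w : Word} : w.elt ∈ r.carrier ↔ w ∈ r.words := by
  constructor
  · rintro ⟨w', hw', h⟩
    rwa [← Word.elt_bijective.1 h]
  · exact fun h => ⟨w, h, rfl⟩

/-- Surjectivity of `Word.elt` reduces equality of subsets of the group to a test on the 24 words.
-/
theorem weylGroup_set_ext {S T : Set weylGroup} (h : ∀ w : Word, w.elt ∈ S ↔ w.elt ∈ T) :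
    S = T := by
  ext σ
  obtain ⟨w, rfl⟩ := Word.elt_bijective.2 σ
  exact h w

theorem Row.isActiveSet_truth {r : Row} :
    r.isActiveSet (truth c₁ c₂ c₃ x y z) = true ↔
      altSet (lam c₁ c₂ c₃ x y z) (weight c₁ c₂ c₃) = r.carrier := by
  have h (w : Word) : (w.active (truth c₁ c₂ c₃ x y z) == r.words.contains w) = true ↔
      (w.elt ∈ altSet (lam c₁ c₂ c₃ x y z) (weight c₁ c₂ c₃) ↔ w.elt ∈ r.carrier) := by
    rw [beq_iff_eq, Bool.eq_iff_iff, Word.active_truth, List.contains_iff_mem,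
      Row.elt_mem_carrier]
  simp only [Row.isActiveSet, List.all_eq_true, h]
  exact ⟨fun h => weylGroup_set_ext fun w => h w w.mem_all, fun h w _ => by rw [h]⟩

theorem carrier_nonempty {r : Row} (hr : r ∈ rows) : r.carrier.Nonempty := by
  have key : (rows.all fun r => !r.words.isEmpty) = true := by decide +kernel
  obtain ⟨w, hw⟩ := List.exists_mem_of_ne_nil r.words (by simpa using List.all_eq_true.1 key r hr)
  exact ⟨w.elt, w, hw, rfl⟩

theorem Row.subset_iff {r r' : Row} : r.subset r' = true ↔ r.carrier ⊆ r'.carrier := by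
  simp only [Row.subset, List.all_eq_true, List.contains_iff_mem]
  constructor
  · rintro h _ ⟨w, hw, rfl⟩
    exact ⟨w, h w hw, rfl⟩
  · exact fun h w hw => Row.elt_mem_carrier.1 (h (Row.elt_mem_carrier.2 hw))

theorem carrier_nodup : (rows.map Row.carrier).Nodup := by
  rw [List.Nodup, List.pairwise_map]
  refine rows_pairwise.imp fun {r r'} h e => ?_
  rw [Row.subset_iff.2 e.subset, Row.subset_iff.2 e.symm.subset] at h
  exact Bool.noConfusion h

theorem eq_of_carrier_eq {r r' : Row} (hr : r ∈ rows) (hr' : r' ∈ rows)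
    (h : r.carrier = r'.carrier) : r = r' :=
  List.inj_on_of_nodup_map carrier_nodup hr hr' h

/-- The two alternatives provided by the classification. -/
theorem classification (c₁ c₂ c₃ : ℕ) (x y z : ℤ) :
    (altSet (lam c₁ c₂ c₃ x y z) (weight c₁ c₂ c₃) = ∅ ∧
      ∀ r ∈ rows, ¬ r.Cond c₁ c₂ c₃ x y z) ∨
    ∃ r₀ ∈ rows, altSet (lam c₁ c₂ c₃ x y z) (weight c₁ c₂ c₃) = r₀.carrier ∧
      ∀ r ∈ rows, r.Cond c₁ c₂ c₃ x y z ↔ r = r₀ := by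
  have h := isClassification_truth c₁ c₂ c₃ x y z
  have mem (r : Row) : r ∈ rows.filter (Row.sat (truth c₁ c₂ c₃ x y z)) ↔
      r ∈ rows ∧ r.Cond c₁ c₂ c₃ x y z := by rw [List.mem_filter, Row.sat_truth]
  generalize rows.filter (Row.sat (truth c₁ c₂ c₃ x y z)) = l at h mem
  match l with
  | [] =>
    refine .inl ⟨weylGroup_set_ext fun w => iff_of_false ?_ (Set.notMem_empty _),
      fun r hr hc => List.not_mem_nil ((mem r).2 ⟨hr, hc⟩)⟩
    simpa [← Word.active_truth] using List.all_eq_true.1 h w w.mem_all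
  | [r₀] =>
    refine .inr ⟨r₀, ((mem r₀).1 (List.mem_singleton_self _)).1, Row.isActiveSet_truth.1 h,
      fun r hr => ?_⟩
    rw [← List.mem_singleton, mem, and_iff_right hr]
  -- Two satisfied rows are impossible, because `isClassification` is false on such a list.
  | _ :: _ :: _ => exact Bool.noConfusion h

/-- The classification names the only satisfied row `r₀`. If the alternation set is that of `r`,
distinctness of the carriers gives `r = r₀`; if no row is satisfied, the set is empty, whereas
carriers are not. -/
theorem altSet_eq_carrier_iff {r : Row} (hr : r ∈ rows) :
    altSet (lam c₁ c₂ c₃ x y z) (weight c₁ c₂ c₃) = r.carrier ↔ r.Cond c₁ c₂ c₃ x y z := by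
  obtain ⟨h, hc⟩ | ⟨r₀, hr₀, h, hc⟩ := classification c₁ c₂ c₃ x y z
  · exact iff_of_false (h ▸ (carrier_nonempty hr).ne_empty.symm) (hc r hr)
  · rw [hc r hr, h]
    exact ⟨fun e => (eq_of_carrier_eq hr₀ hr e).symm, fun e => by rw [e]⟩

theorem altSet_eq_empty_iff :
    altSet (lam c₁ c₂ c₃ x y z) (weight c₁ c₂ c₃) = ∅ ↔ ∀ r ∈ rows, ¬ r.Cond c₁ c₂ c₃ x y z := by
  obtain ⟨h, hc⟩ | ⟨r₀, hr₀, h, hc⟩ := classification c₁ c₂ c₃ x y z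
  · exact iff_of_true h hc
  · exact iff_of_false (h ▸ (carrier_nonempty hr₀).ne_empty) fun h' => h' r₀ hr₀ ((hc r₀ hr₀).2 rfl)

end

/-! ### The sets that occur, their number and their maximal size -/

/-- At `(-1, -1, 0)`, that is for `λ = μ - α₁ - α₂`, all four possible coefficients `L₁`, `L₂`,
`L₃`, `L₄` of `α₁` are negative, so no element survives and the other two coefficients need not be
examined. -/
theorem altSet_eq_empty (c₁ c₂ c₃ : ℕ) :
    altSet (lam c₁ c₂ c₃ (-1) (-1) 0) (weight c₁ c₂ c₃) = ∅ := by
  refine weylGroup_set_ext fun w => iff_of_false ?_ (Set.notMem_empty _)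
  rw [Word.elt_mem_altSet]
  rintro ⟨h, -, -⟩
  cases w <;> simp only [Word.coeffs, Label.Holds, Label.form] at h <;> omega

theorem range_altSet (c₁ c₂ c₃ : ℕ) :
    {S | ∃ x y z : ℤ, altSet (lam c₁ c₂ c₃ x y z) (weight c₁ c₂ c₃) = S} =
      insert ∅ {S | ∃ r ∈ rows, r.carrier = S} := by
  ext S
  constructor
  · rintro ⟨x, y, z, rfl⟩
    obtain ⟨h, -⟩ | ⟨r₀, hr₀, h, -⟩ := classification c₁ c₂ c₃ x y z
    · exact .inl h
    · exact .inr ⟨r₀, hr₀, h.symm⟩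
  · rintro (rfl | ⟨r, hr, rfl⟩)
    · exact ⟨_, _, _, altSet_eq_empty c₁ c₂ c₃⟩
    · obtain ⟨x, y, z, h⟩ := exists_cond hr c₁ c₂ c₃
      exact ⟨x, y, z, (altSet_eq_carrier_iff hr).2 h⟩

theorem rows_length : rows.length = 194 := by
  decide +kernel

theorem ncard_insert_carriers :
    (insert ∅ {S | ∃ r ∈ rows, r.carrier = S} : Set (Set weylGroup)).ncard = 195 := by
  classical
  have h : {S | ∃ r ∈ rows, r.carrier = S} = ((rows.map Row.carrier).toFinset : Set _) := by
    ext S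
    simp
  -- No row lists the empty set, so it adds one to the 194 distinct carriers.
  have h₀ : ∅ ∉ {S | ∃ r ∈ rows, r.carrier = S} := by
    rintro ⟨r, hr, h⟩
    exact (carrier_nonempty hr).ne_empty h
  rw [h] at h₀ ⊢
  rw [Set.ncard_insert_of_notMem h₀, Set.ncard_coe_finset,
    List.toFinset_card_of_nodup carrier_nodup, List.length_map, rows_length]

theorem Row.ncard_carrier {r : Row} (h : r.words.Nodup) : r.carrier.ncard = r.words.length := by
  have e : r.carrier = Word.elt '' (r.words.toFinset : Set Word) := by
    ext σ
    simp [Row.carrier]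
  rw [e, Set.ncard_image_of_injective _ Word.elt_bijective.1, Set.ncard_coe_finset,
    List.toFinset_card_of_nodup h]

theorem words_nodup : ∀ r ∈ rows, r.words.Nodup ∧ r.words.length ≤ 6 := by
  decide +kernel

theorem exists_words_length : ∃ r ∈ rows, r.words.length = 6 := by
  decide +kernel

theorem isGreatest_ncard_altSet (c₁ c₂ c₃ : ℕ) :
    IsGreatest {n : ℕ | ∃ x y z : ℤ,
      (altSet (lam c₁ c₂ c₃ x y z) (weight c₁ c₂ c₃)).ncard = n} 6 := by
  constructor
  · obtain ⟨r, hr, hl⟩ := exists_words_length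
    obtain ⟨x, y, z, h⟩ := exists_cond hr c₁ c₂ c₃
    exact ⟨x, y, z, by
      rw [(altSet_eq_carrier_iff hr).2 h, Row.ncard_carrier (words_nodup r hr).1, hl]⟩
  · rintro _ ⟨x, y, z, rfl⟩
    obtain ⟨h, -⟩ | ⟨r, hr, h, -⟩ := classification c₁ c₂ c₃ x y z
    · simp [h]
    · rw [h, Row.ncard_carrier (words_nodup r hr).1]
      exact (words_nodup r hr).2

end SL4

theorem theorem4p2 :
    -- the 24 words represent every element of the Weyl group exactly once
    Function.Bijective SL4.Word.elt ∧
    ∀ c₁ c₂ c₃ : ℕ,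
      -- `μ` is fixed, `λ` depends on the integers `x`, `y`, `z`
      let μ : SL4.V := SL4.weight c₁ c₂ c₃
      let lam : ℤ → ℤ → ℤ → SL4.V := fun x y z =>
        SL4.weight (2 * x - y + c₁) (2 * y - x - z + c₂) (2 * z - y + c₃)
      -- `σ(λ + ρ) - ρ - μ` in the basis of simple roots, for all `σ`
      (∀ (x y z : ℤ) (w : SL4.Word),
        (w.elt : SL4.V ≃ₗᵢ[ℝ] SL4.V) (lam x y z + SL4.ρ) - SL4.ρ - μ =
          (w.coeffs.1.form c₁ c₂ c₃ x y z : ℝ) • SL4.α 0 +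
          (w.coeffs.2.1.form c₁ c₂ c₃ x y z : ℝ) • SL4.α 1 +
          (w.coeffs.2.2.form c₁ c₂ c₃ x y z : ℝ) • SL4.α 2) ∧
      -- membership of each `σ` in the alternation set
      (∀ (x y z : ℤ) (w : SL4.Word), w.elt ∈ SL4.altSet (lam x y z) μ ↔
        w.coeffs.1.Holds c₁ c₂ c₃ x y z ∧ w.coeffs.2.1.Holds c₁ c₂ c₃ x y z ∧
          w.coeffs.2.2.Holds c₁ c₂ c₃ x y z) ∧
      -- the 194 nonempty sets, each with its linear conditions
      (SL4.rows.length = 194 ∧ ∀ r ∈ SL4.rows, r.carrier.Nonempty ∧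
        ∀ x y z : ℤ, SL4.altSet (lam x y z) μ = r.carrier ↔ r.Cond c₁ c₂ c₃ x y z) ∧
      -- the alternation set is empty in all other cases
      (∀ x y z : ℤ, SL4.altSet (lam x y z) μ = ∅ ↔
        ∀ r ∈ SL4.rows, ¬ r.Cond c₁ c₂ c₃ x y z) ∧
      -- exactly the listed sets and the empty set occur
      {S | ∃ x y z : ℤ, SL4.altSet (lam x y z) μ = S} =
        insert ∅ {S | ∃ r ∈ SL4.rows, r.carrier = S} ∧
      -- there are 195 of them
      {S | ∃ x y z : ℤ, SL4.altSet (lam x y z) μ = S}.ncard = 195 ∧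
      -- the maximal cardinality is 6
      IsGreatest {n : ℕ | ∃ x y z : ℤ, (SL4.altSet (lam x y z) μ).ncard = n} 6 := by
  refine ⟨SL4.Word.elt_bijective, fun c₁ c₂ c₃ => ⟨fun x y z w => w.elt_lam_add_ρ c₁ c₂ c₃ x y z,
    fun x y z w => w.elt_mem_altSet c₁ c₂ c₃ x y z,
    ⟨SL4.rows_length, fun r hr => ⟨SL4.carrier_nonempty hr,
      fun x y z => SL4.altSet_eq_carrier_iff hr⟩⟩,
    fun x y z => SL4.altSet_eq_empty_iff, SL4.range_altSet c₁ c₂ c₃, ?_,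
    SL4.isGreatest_ncard_altSet c₁ c₂ c₃⟩⟩
  exact (congrArg Set.ncard (SL4.range_altSet c₁ c₂ c₃)).trans SL4.ncard_insert_carriers
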